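/- Let $d\ge 1$, let $\Delta_d=\mathrm{conv}\{e_1,\dots,e_d\}\subset\mathbb R^d$, and let $f:\mathbb R^d\to\mathbb R$ be convex and $L$-smooth, i.e. differentiable with $\|\nabla f(x)-\nabla f(y)\|_2\le L\|x-y\|_2$ for all $x,y\in\mathbb R^d$. Let $$C_f=\sup\Big\{\tfrac{2}{\beta^2}\big(f(y)-f(x)-\langle y-x,\nabla f(x)\rangle\big)\;:\; x,s\in\Delta_d,\ \beta\in(0,1],\ y=x+\beta(s-x)\Big\}$$ be its curvature over $\Delta_d$, and assume $C_f>0$. The function $f$ is accessed through the unitary $U_f:|x\rangle|a\rangle\mapsto|x\rangle|a+f(x)\rangle$ (and its inverse), where $x\in\mathbb R^d$ and $a\in\mathbb R$. Let $\varepsilon>0$ and $0<p<1$, let $T$ be $\frac{4C_f}{\varepsilon}-2$ rounded up to a positive integer, let $\gamma_t=\frac{2}{t+2}$ and $\sigma_t=\frac{C_f}{\sqrt d\,L\,(t+2)}$, and let $x^{(0)}\in\Delta_d$ be arbitrary. The quantum Frank–Wolfe algorithm over the simplex performs the following in each round $t=0,1,\dots,T-1$. By means of a circuit with two calls to $U_f$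 that adds $-g_i$ to a value register, where $g_i=\frac{f(x^{(t)}+\sigma_t e_i)-f(x^{(t)})}{\sigma_t}$ is the forward-difference estimate of $\nabla_i f(x^{(t)})$, it applies quantum maximum finding to the values $-g_1,\dots,-g_d$ (signed, no absolute values; equivalently, it searches for the minimal $g_i$), obtains an index $i_t$, and sets $x^{(t+1)}=(1-\gamma_t)x^{(t)}+\gamma_t e_{i_t}$. There are an absolute constant $K$ and, for every $d\ge 1$ and $\delta\in(0,1)$, a quantum maximum finding algorithm (one which, for any $d$ real values accessed only through a value oracle, returns an index of a maximal value with probability at least $1-\delta$) such that the quantum Frank–Wolfe algorithm that uses it with $\delta=p/T$ outputs, for all $f,L,\varepsilon,p,x^{(0)}$ as above, with probability at least $1-p$ a point $x^{(T)}\in\Delta_d$ with $$f(x^{(T)})-\min_{x\in\Delta_d}f(x)\le\varepsilon$$ after $T$ rounds, with at most $K\sqrt d\,\log\max\{2,\ \max\{1,C_f/\varepsilon\}/p\}$ calls to $U_f$ or $U_f^{-1}$ in each round. (The last bound is $K\sqrt d\,\log\frac{C_f}{p\varepsilon}$ when $\varepsilon\le C_f$ and $C_f/(p\varepsilon)\ge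 2$.) -/

import Mathlib

open scoped ENNReal

namespace QuantumFW

noncomputable section

/-! ### Constrained convex optimization -/

/-- The probability simplex `conv {e_1, …, e_d}` in `ℝ^d`. -/
def simplex (d : ℕ) : Set (EuclideanSpace ℝ (Fin d)) :=
  convexHull ℝ (Set.range fun i : Fin d => EuclideanSpace.single i (1 : ℝ))

/-- `f` is differentiable on `ℝ^d` with `L`-Lipschitz gradient in the Euclidean norm. -/
def IsLSmooth {d : ℕ} (L : ℝ) (f : EuclideanSpace ℝ (Fin d) → ℝ) : Prop :=
  Differentiable ℝ f ∧ ∀ x y, ‖gradient f x - gradient f y‖ ≤ L * ‖x - y‖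

/-- The curvature `C_f` of `f` over the constraint set `D`. -/
def curvature {d : ℕ} (f : EuclideanSpace ℝ (Fin d) → ℝ)
    (D : Set (EuclideanSpace ℝ (Fin d))) : ℝ :=
  sSup {r : ℝ | ∃ x ∈ D, ∃ s ∈ D, ∃ β ∈ Set.Ioc (0 : ℝ) 1, ∃ y, y = x + β • (s - x) ∧
    r = 2 / β ^ 2 * (f y - f x - inner ℝ (y - x) (gradient f x))}

/-- `x` is an `ε`-optimal solution of the minimization of `f` over `D`. -/
def IsEpsOptimal {d : ℕ} (f : EuclideanSpace ℝ (Fin d) → ℝ)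
    (D : Set (EuclideanSpace ℝ (Fin d))) (ε : ℝ) (x : EuclideanSpace ℝ (Fin d)) : Prop :=
  x ∈ D ∧ ∀ y ∈ D, f x - f y ≤ ε

/-! ### States, unitaries, measurement -/

/-- The Hilbert space `ℓ²(B)` with computational basis labelled by `B`. -/
abbrev StateSpace (B : Type) : Type := lp (fun _ : B => ℂ) 2

/-- Unitary operators on `ℓ²(B)`. -/
abbrev Unitary (B : Type) : Type := StateSpace B ≃ₗᵢ[ℂ] StateSpace B

open Classical in
/-- The computational basis state `|b⟩`. -/
def ket {B : Type} (b : B) : StateSpace B := lp.single 2 b (1 : ℂ)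

theorem norm_ket {B : Type} (b : B) : ‖ket b‖ = 1 := by
  classical
  unfold ket
  rw [lp.norm_single (by norm_num)]
  simp

theorem memlp_comp {B : Type} (e : B ≃ B) (ψ : StateSpace B) :
    Memℓp (fun b => (ψ : B → ℂ) (e b)) 2 := by
  have h := (lp.memℓp ψ).summable (by norm_num)
  exact memℓp_gen ((e.summable_iff
    (f := fun b => ‖(ψ : B → ℂ) b‖ ^ (2 : ℝ≥0∞).toReal)).2 h)

/-- The unitary `|b⟩ ↦ |e b⟩` that permutes the computational basis. -/
def permUnitary {B : Type} (e : B ≃ B) : Unitary B where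
  toFun ψ := ⟨fun b => (ψ : B → ℂ) (e.symm b), memlp_comp e.symm ψ⟩
  invFun ψ := ⟨fun b => (ψ : B → ℂ) (e b), memlp_comp e ψ⟩
  left_inv ψ := by ext b; simp
  right_inv ψ := by ext b; simp
  map_add' ψ φ := rfl
  map_smul' c ψ := by ext b; simp
  norm_map' ψ := by
    have h2 : 0 < (2 : ℝ≥0∞).toReal := by norm_num
    rw [lp.norm_eq_tsum_rpow h2, lp.norm_eq_tsum_rpow h2]
    congr 1
    exact e.symm.tsum_eq fun b => ‖(ψ : B → ℂ) b‖ ^ (2 : ℝ≥0∞).toReal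

theorem permUnitary_ket {B : Type} (e : B ≃ B) (b : B) :
    permUnitary e (ket b) = ket (e b) := by
  classical
  ext b'
  change (ket b : B → ℂ) (e.symm b') = (ket (e b) : B → ℂ) b'
  simp only [ket, lp.single_apply, Pi.single_apply, Equiv.symm_apply_eq]

theorem sum_born {B : Type} (ψ : StateSpace B) (h : ‖ψ‖ = 1) :
    HasSum (fun b => ENNReal.ofReal (‖(ψ : B → ℂ) b‖ ^ 2)) 1 := by
  have h2 : 0 < (2 : ℝ≥0∞).toReal := by norm_num
  have hs := lp.hasSum_norm h2 ψ
  simp only [h, ENNReal.toReal_ofNat, Real.rpow_ofNat, one_pow] at hs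
  have := ENNReal.ofReal_tsum_of_nonneg (fun b => sq_nonneg ‖(ψ : B → ℂ) b‖) hs.summable
  rw [hs.tsum_eq, ENNReal.ofReal_one] at this
  rw [this]
  exact ENNReal.summable.hasSum

/-- Measurement of all registers of a unit vector `ψ` in the computational basis: outcome `b`
has probability `|ψ_b|²`. -/
def measure {B : Type} (ψ : StateSpace B) (h : ‖ψ‖ = 1) : PMF B :=
  ⟨fun b => ENNReal.ofReal (‖(ψ : B → ℂ) b‖ ^ 2), sum_born ψ h⟩

/-! ### Quantum query circuits and programs -/

/-- A gate of a quantum query circuit: a unitary that does not depend on the oracle, one call to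
the oracle `U`, or one call to its inverse `U†`. -/
inductive Gate (B : Type) : Type
  | free (V : Unitary B)
  | query
  | queryInv

/-- A quantum query circuit; the head of the list is applied first. -/
abbrev Circuit (B : Type) : Type := List (Gate B)

/-- The unitary of a gate when the oracle is `U`. -/
def Gate.eval {B : Type} (U : Unitary B) : Gate B → Unitary B
  | .free V => V
  | .query => U
  | .queryInv => U.symm

/-- The inverse gate. -/
def Gate.inv {B : Type} : Gate B → Gate B
  | .free V => .free V.symm
  | .query => .queryInv
  | .queryInv => .query

/-- The number of oracle calls of a gate. -/
def Gate.queries {B : Type} : Gate B → ℕ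
  | .free _ => 0
  | .query => 1
  | .queryInv => 1

/-- The unitary of a circuit when the oracle is `U`. -/
def Circuit.eval {B : Type} (U : Unitary B) : Circuit B → Unitary B
  | [] => LinearIsometryEquiv.refl ℂ _
  | g :: c => (g.eval U).trans (Circuit.eval U c)

/-- The inverse circuit. -/
def Circuit.inv {B : Type} (c : Circuit B) : Circuit B := (c.map Gate.inv).reverse

/-- The number of oracle calls of a circuit. -/
def Circuit.queries {B : Type} (c : Circuit B) : ℕ := (c.map Gate.queries).sum

/-- The circuit obtained from `c` by replacing every oracle call by the circuit `G` and every
inverse oracle call by the inverse of `G`. -/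
def Circuit.expand {B : Type} (G : Circuit B) (c : Circuit B) : Circuit B :=
  c.flatMap fun g => match g with
    | .free V => [.free V]
    | .query => G
    | .queryInv => Circuit.inv G

/-- A classically controlled quantum query program with output in `ι`: either output a value, or
prepare the basis state `|init⟩`, apply the circuit `c`, measure all registers, and continue as
prescribed by the measurement outcome. -/
inductive Program (B ι : Type) : Type
  | output (i : ι)
  | run (init : B) (c : Circuit B) (next : B → Program B ι)

/-- The distribution of the output of a program when the oracle is `U`. -/
def Program.dist {B ι : Type} (U : Unitary B) : Program B ι → PMF ι
  | .output i => PMF.pure i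
  | .run init c next =>
      (measure (Circuit.eval U c (ket init))
        (((Circuit.eval U c).norm_map _).trans (norm_ket init))).bind fun b => (next b).dist U

/-- The number of oracle calls of a program in the worst case over all measurement outcomes. -/
def Program.queries {B ι : Type} : Program B ι → ℕ∞
  | .output _ => 0
  | .run _ c next => (Circuit.queries c : ℕ∞) + ⨆ b, (next b).queries

/-- Replace every oracle call of a program by the circuit `G`. -/
def Program.expand {B ι : Type} (G : Circuit B) : Program B ι → Program B ι
  | .output i => .output i
  | .run init c next => .run init (Circuit.expand G c) fun b => (next b).expand G

/-! ### The registers, the function value oracle and the gradient circuit -/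

/-- Basis labels `|i⟩|x⟩|a⟩`: an index, a point of `ℝ^d` and a real value. -/
abbrev Reg (d : ℕ) : Type := Fin d × EuclideanSpace ℝ (Fin d) × ℝ

/-- The unitary `|i⟩|x⟩|a⟩ ↦ |i⟩|x⟩|a + v x i⟩`. -/
def valueOracle {d : ℕ} (v : EuclideanSpace ℝ (Fin d) → Fin d → ℝ) : Unitary (Reg d) :=
  permUnitary
    { toFun := fun r => (r.1, r.2.1, r.2.2 + v r.2.1 r.1)
      invFun := fun r => (r.1, r.2.1, r.2.2 - v r.2.1 r.1)
      left_inv := fun r => by simp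
      right_inv := fun r => by simp }

/-- The function value oracle `U_f : |x⟩|a⟩ ↦ |x⟩|a + f x⟩`, acting trivially on the index. -/
def functionOracle {d : ℕ} (f : EuclideanSpace ℝ (Fin d) → ℝ) : Unitary (Reg d) :=
  valueOracle fun x _ => f x

/-- The gate `|i⟩|x⟩|a⟩ ↦ |i⟩|x + σ e_i⟩|a⟩`. -/
def shiftGate {d : ℕ} (σ : ℝ) : Unitary (Reg d) :=
  permUnitary
    { toFun := fun r => (r.1, r.2.1 + σ • EuclideanSpace.single r.1 (1 : ℝ), r.2.2)
      invFun := fun r => (r.1, r.2.1 - σ • EuclideanSpace.single r.1 (1 : ℝ), r.2.2)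
      left_inv := fun r => by simp
      right_inv := fun r => by simp }

/-- The gate `|i⟩|x⟩|a⟩ ↦ |i⟩|x⟩|c a⟩` for `c ≠ 0` (and the identity for `c = 0`). -/
def scaleGate {d : ℕ} (c : ℝ) : Unitary (Reg d) :=
  permUnitary
    ((Equiv.refl _).prodCongr ((Equiv.refl _).prodCongr
      (if h : c = 0 then Equiv.refl ℝ else Equiv.mulLeft₀ c h)))

/-- The gradient circuit `U_g : |i⟩|x⟩|a⟩ ↦ |i⟩|x⟩|a + (f (x + σ e_i) - f x) / σ⟩`, built with two
calls to the function value oracle. -/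
def gradCircuit (d : ℕ) (σ : ℝ) : Circuit (Reg d) :=
  [.free (scaleGate σ), .free (shiftGate σ), .query, .free (shiftGate σ).symm, .queryInv,
    .free (scaleGate σ).symm]

/-- The gradient circuit with its value negated:
`|i⟩|x⟩|a⟩ ↦ |i⟩|x⟩|a - (f (x + σ e_i) - f x) / σ⟩`. -/
def negGradCircuit (d : ℕ) (σ : ℝ) : Circuit (Reg d) :=
  .free (scaleGate (-1)) :: (gradCircuit d σ ++ [.free (scaleGate (-1))])

/-! ### Quantum maximum finding and the quantum Frank-Wolfe algorithm -/

/-- A program for each (classically known) point `x`, returning an index; it accesses the values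
only through the oracle. -/
abbrev IndexFinder (d : ℕ) : Type := EuclideanSpace ℝ (Fin d) → Program (Reg d) (Fin d)

/-- `A` is a quantum maximum finding algorithm with failure probability at most `δ`: given
whatever oracle `|i⟩|x⟩|a⟩ ↦ |i⟩|x⟩|a + v x i⟩`, it returns an index that maximizes `v x`, with
probability at least `1 - δ`. -/
def IsMaxFinding {d : ℕ} (A : IndexFinder d) (δ : ℝ) : Prop :=
  ∀ (v : EuclideanSpace ℝ (Fin d) → Fin d → ℝ) (x : EuclideanSpace ℝ (Fin d)),
    ENNReal.ofReal (1 - δ) ≤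
      ((A x).dist (valueOracle v)).toOuterMeasure {i | ∀ j, v x j ≤ v x i}

/-- The quantum part of a round at the point `x` with gradient precision `σ`, as a program that
calls the function value oracle: maximum finding applied to the negated gradient estimates. -/
def roundProgram {d : ℕ} (A : IndexFinder d) (σ : ℝ) (x : EuclideanSpace ℝ (Fin d)) :
    Program (Reg d) (Fin d) :=
  (A x).expand (negGradCircuit d σ)

/-- The step size `γ_t = 2 / (t + 2)`. -/
def stepSize (t : ℕ) : ℝ := 2 / ((t : ℝ) + 2)

/-- The distribution of the iterate `x^(t)` of the quantum Frank-Wolfe algorithm over the simplex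
for the objective function `f`, with maximum finding routine `A`, gradient precisions `σ_t` and
initial point `x₀`. -/
def quantumFW {d : ℕ} (f : EuclideanSpace ℝ (Fin d) → ℝ) (A : IndexFinder d) (σ : ℕ → ℝ)
    (x₀ : EuclideanSpace ℝ (Fin d)) : ℕ → PMF (EuclideanSpace ℝ (Fin d))
  | 0 => PMF.pure x₀
  | t + 1 => (quantumFW f A σ x₀ t).bind fun x =>
      ((roundProgram A (σ t) x).dist (functionOracle f)).map fun i =>
        (1 - stepSize t) • x + stepSize t • EuclideanSpace.single i (1 : ℝ)

/-- The gradient precision `σ_t = C / (√d L (t + 2))`. -/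
def gradPrecision (d : ℕ) (L C : ℝ) (t : ℕ) : ℝ := C / (√(d : ℝ) * L * ((t : ℝ) + 2))

/-- The number of rounds `T = 4 C / ε - 2`, rounded up to a positive integer. -/
def numRounds (C ε : ℝ) : ℕ := max 1 ⌈4 * C / ε - 2⌉₊

end

end QuantumFW

namespace QuantumFW

noncomputable section

/-! ### Unitaries on the computational basis -/

/-! The proof joins a maximum finder correct for every value oracle to a Frank–Wolfe analysis that
tolerates a small error in the linear minimization.

Maximum finding keeps a current index and Grover-searches for larger values. With `j` iterations the
Grover angle `θ` becomes `(2j+1)θ` (`groverAmplitude_succ`), and a successful search lands uniformly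
among the better indices, which on average halves the number of better ones (`sum_numBetter_le`).
The success probability is unknown, so the iteration numbers follow a fixed schedule in which `2j+1`
runs through powers of three: one of them brings `θ` into `[π/6, π/2]`, where success has
probability at least `1/4`. A stage reaching up to `3 ^ s` thus contracts the expected count by
`7/8` whenever the count is at least `d / 9 ^ s`. Growing stages bring the expected count below a
constant (`expectation_warmup_le`); repeating the last stage brings it below `δ`. By Markov's
inequality this bounds the failure probability (`search_failure_le`). Costs grow geometrically, so
the last stage, of order `√d`, dominates.

Substituting the negated gradient circuit for the oracle gives exactly the value oracle of the
negated forward differences (`dist_expand`, `eval_negGradCircuit`), at two calls per query. These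
differences exceed the partial derivatives by at most `L * σ`, which is at most `γ_t * C / 2`. Hence
a round with an optimal index sends the gap `h` to at most `(1 - γ_t) * h + γ_t ^ 2 * C`, and
induction gives `4 * C / (t + 2)`. All rounds succeed with probability at least `(1 - p / T) ^ T ≥ 1
- p`. -/

theorem inner_ket {B : Type} (b : B) (ψ : StateSpace B) :
    inner ℂ (ket b) ψ = (ψ : B → ℂ) b := by
  classical
  simp [ket, lp.inner_single_left]

theorem ket_apply {B : Type} [DecidableEq B] (b c : B) :
    (ket b : B → ℂ) c = if c = b then 1 else 0 := by
  simp only [ket, lp.single_apply, Pi.single_apply]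
  congr

theorem permUnitary_symm_ket {B : Type} (e : B ≃ B) (b : B) :
    (permUnitary e).symm (ket b) = ket (e.symm b) := by
  rw [LinearIsometryEquiv.symm_apply_eq, permUnitary_ket, e.apply_symm_apply]

open Classical in
theorem memlp_signFlip {B : Type} (s : Set B) (ψ : StateSpace B) :
    Memℓp (fun b => (if b ∈ s then -1 else 1) * (ψ : B → ℂ) b) 2 :=
  (lp.memℓp ψ).mono' fun b => by split_ifs <;> simp

open Classical in
/-- The diagonal unitary that flips the sign of the basis states labelled by `s`. -/
def signFlip {B : Type} (s : Set B) : Unitary B where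
  toFun ψ := ⟨fun b => (if b ∈ s then -1 else 1) * (ψ : B → ℂ) b, memlp_signFlip s ψ⟩
  invFun ψ := ⟨fun b => (if b ∈ s then -1 else 1) * (ψ : B → ℂ) b, memlp_signFlip s ψ⟩
  left_inv ψ := by ext b; simp only; split_ifs <;> simp
  right_inv ψ := by ext b; simp only; split_ifs <;> simp
  map_add' ψ φ := by ext b; exact mul_add _ _ _
  map_smul' c ψ := by ext b; simp
  norm_map' ψ := by
    have h2 : 0 < (2 : ℝ≥0∞).toReal := by norm_num
    rw [lp.norm_eq_tsum_rpow h2, lp.norm_eq_tsum_rpow h2]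
    congr 1
    refine tsum_congr fun b => ?_
    change ‖(if b ∈ s then -1 else 1) * (ψ : B → ℂ) b‖ ^ _ = _
    split_ifs <;> simp

open Classical in
theorem signFlip_ket {B : Type} (s : Set B) (b : B) :
    signFlip s (ket b) = (if b ∈ s then -1 else 1 : ℂ) • ket b := by
  ext c
  change (if c ∈ s then -1 else 1) * (ket b : B → ℂ) c =
    (if b ∈ s then -1 else 1) * (ket b : B → ℂ) c
  rw [ket_apply]
  split_ifs <;> simp_all

/-- A reflection maps `u` to `w` if both vectors have the same norm and real inner product. -/
theorem reflection_sub_complex {E : Type*} [NormedAddCommGroup E] [InnerProductSpace ℂ E]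
    {u w : E} (h : ‖u‖ = ‖w‖) (hr : inner ℂ u w = inner ℂ w u) :
    (ℂ ∙ (u - w))ᗮ.reflection u = w := by
  -- Equal norms and a symmetric inner product make `u + w` orthogonal to `u - w`; the reflection
  -- fixes the former and negates the latter.
  have h1 : (ℂ ∙ (u - w))ᗮ.reflection (u + w) = u + w := by
    refine Submodule.reflection_mem_subspace_eq_self ?_
    rw [Submodule.mem_orthogonal_singleton_iff_inner_right]
    simp only [inner_sub_left, inner_add_right, inner_self_eq_norm_sq_to_K, h, hr]
    ring
  have h2 := Submodule.reflection_orthogonalComplement_singleton_eq_neg (𝕜 := ℂ) (u - w)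
  have h3 : (2 : ℂ) • (ℂ ∙ (u - w))ᗮ.reflection u = (2 : ℂ) • w := by
    rw [← map_smul, show (2 : ℂ) • u = (u + w) + (u - w) by rw [two_smul]; abel, map_add, h1, h2,
      two_smul]
    abel
  exact smul_right_injective E (two_ne_zero' ℂ) h3

/-! ### Superpositions over the index register -/

/-- The state `∑ i, α i |i⟩|x⟩|a i⟩`. -/
def superposition {d : ℕ} (x : EuclideanSpace ℝ (Fin d)) (a α : Fin d → ℝ) :
    StateSpace (Reg d) :=
  ∑ i, (α i : ℂ) • ket (i, x, a i)

variable {d : ℕ}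

theorem valueOracle_ket (v : EuclideanSpace ℝ (Fin d) → Fin d → ℝ) (r : Reg d) :
    valueOracle v (ket r) = ket (r.1, r.2.1, r.2.2 + v r.2.1 r.1) :=
  permUnitary_ket _ _

theorem valueOracle_symm_ket (v : EuclideanSpace ℝ (Fin d) → Fin d → ℝ) (r : Reg d) :
    (valueOracle v).symm (ket r) = ket (r.1, r.2.1, r.2.2 - v r.2.1 r.1) :=
  permUnitary_symm_ket _ _

theorem valueOracle_superposition (v : EuclideanSpace ℝ (Fin d) → Fin d → ℝ)
    (x : EuclideanSpace ℝ (Fin d)) (a α : Fin d → ℝ) :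
    valueOracle v (superposition x a α) = superposition x (fun i => a i + v x i) α := by
  simp only [superposition, map_sum, map_smul, valueOracle_ket]

theorem valueOracle_symm_superposition (v : EuclideanSpace ℝ (Fin d) → Fin d → ℝ)
    (x : EuclideanSpace ℝ (Fin d)) (a α : Fin d → ℝ) :
    (valueOracle v).symm (superposition x a α) = superposition x (fun i => a i - v x i) α := by
  simp only [superposition, map_sum, map_smul, valueOracle_symm_ket]

open Classical in
theorem signFlip_superposition (s : Set (Reg d)) (x : EuclideanSpace ℝ (Fin d))
    (a α : Fin d → ℝ) :
    signFlip s (superposition x a α) =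
      superposition x a fun i => (if (i, x, a i) ∈ s then -1 else 1) * α i := by
  simp only [superposition, map_sum, map_smul, signFlip_ket]
  refine Finset.sum_congr rfl fun i _ => ?_
  split_ifs <;> simp

theorem superposition_apply (x : EuclideanSpace ℝ (Fin d)) (a α : Fin d → ℝ) (r : Reg d) :
    (superposition x a α : Reg d → ℂ) r = if r.2 = (x, a r.1) then (α r.1 : ℂ) else 0 := by
  classical
  rw [← inner_ket, superposition, inner_sum]
  simp only [inner_smul_right, inner_ket, ket_apply]
  rw [Finset.sum_eq_single r.1]
  · obtain ⟨i, r⟩ := r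
    simp
  · intro i _ hi
    rw [if_neg, mul_zero]
    exact fun h => hi (congrArg Prod.fst h).symm
  · simp

theorem inner_superposition (x : EuclideanSpace ℝ (Fin d)) (a α β : Fin d → ℝ) :
    inner ℂ (superposition x a α) (superposition x a β) = ((∑ i, α i * β i : ℝ) : ℂ) := by
  conv_lhs => rw [superposition, sum_inner]
  simp only [inner_smul_left, inner_ket, superposition_apply, if_true, Complex.conj_ofReal]
  push_cast
  rfl

theorem ket_eq_superposition (i : Fin d) (x : EuclideanSpace ℝ (Fin d)) :
    ket (i, x, (0 : ℝ)) = superposition x 0 (Pi.single i 1) := by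
  rw [superposition, Finset.sum_eq_single i] <;> simp +contextual

/-- Only the labels `(i, x, a i)` carry amplitude, so the sum over an uncountable label set
collapses to one over indices. -/
theorem measure_bind_superposition {ι : Type} (x : EuclideanSpace ℝ (Fin d)) (a α : Fin d → ℝ)
    {ψ : StateSpace (Reg d)} (h : ‖ψ‖ = 1) (hψ : ψ = superposition x a α)
    (k : Reg d → PMF ι) (s : Set ι) :
    ((measure ψ h).bind k).toOuterMeasure s =
      ∑ i, ENNReal.ofReal (α i ^ 2) * (k (i, x, a i)).toOuterMeasure s := by
  subst hψ
  rw [PMF.toOuterMeasure_bind_apply]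
  have hm : ∀ r, measure (superposition x a α) h r =
      ENNReal.ofReal (‖(superposition x a α : Reg d → ℂ) r‖ ^ 2) := fun _ => rfl
  have hinj : Function.Injective fun i : Fin d => ((i, x, a i) : Reg d) :=
    fun i j hij => congrArg Prod.fst hij
  rw [← hinj.tsum_eq, tsum_fintype]
  · simp [hm, superposition_apply]
  · intro r hr
    by_cases hr2 : r.2 = (x, a r.1)
    · exact ⟨r.1, by simp [← hr2]⟩
    · simp [hm, superposition_apply, hr2] at hr

/-! ### Grover search -/

/-- The uniform superposition over the index register. -/
def uniformState (x : EuclideanSpace ℝ (Fin d)) : StateSpace (Reg d) :=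
  superposition x 0 fun _ => (√(d : ℝ))⁻¹

theorem norm_uniformState [NeZero d] (x : EuclideanSpace ℝ (Fin d)) : ‖uniformState x‖ = 1 := by
  have h1 := inner_self_eq_norm_sq_to_K (𝕜 := ℂ) (uniformState x)
  have hd : (0 : ℝ) < d := by exact_mod_cast Nat.pos_of_ne_zero (NeZero.ne d)
  nth_rw 1 2 [uniformState] at h1
  rw [inner_superposition] at h1
  have h2 : ∑ _i : Fin d, (√(d : ℝ))⁻¹ * (√(d : ℝ))⁻¹ = 1 := by
    rw [Finset.sum_const, ← mul_inv, Real.mul_self_sqrt hd.le]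
    simp [hd.ne']
  rw [h2] at h1
  have h3 : ‖uniformState x‖ ^ 2 = 1 := Complex.ofReal_injective (by simpa using h1.symm)
  exact (pow_eq_one_iff_of_nonneg (norm_nonneg _) two_ne_zero).1 h3

/-- A unitary that maps `|i⟩|x⟩|0⟩` to the uniform superposition. -/
def prepare (x : EuclideanSpace ℝ (Fin d)) (i : Fin d) : Unitary (Reg d) :=
  (ℂ ∙ (ket (i, x, (0 : ℝ)) - uniformState x))ᗮ.reflection

theorem prepare_ket [NeZero d] (x : EuclideanSpace ℝ (Fin d)) (i : Fin d) :
    prepare x i (ket (i, x, 0)) = uniformState x := by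
  refine reflection_sub_complex (by rw [norm_ket, norm_uniformState]) ?_
  rw [ket_eq_superposition, uniformState, inner_superposition, inner_superposition]
  simp only [mul_comm]

/-- The inversion about the uniform superposition. -/
def diffusion (x : EuclideanSpace ℝ (Fin d)) : Unitary (Reg d) :=
  (ℂ ∙ uniformState x).reflection

theorem diffusion_superposition [NeZero d] (x : EuclideanSpace ℝ (Fin d)) (α : Fin d → ℝ) :
    diffusion x (superposition x 0 α) = superposition x 0 fun i => 2 * (∑ k, α k) / d - α i := by
  have hd : (0 : ℝ) < d := by exact_mod_cast Nat.pos_of_ne_zero (NeZero.ne d)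
  rw [diffusion, Submodule.reflection_apply,
    Submodule.starProjection_unit_singleton ℂ (norm_uniformState x)]
  conv_lhs => enter [1, 2, 1]; rw [uniformState, inner_superposition]
  rw [uniformState]
  simp only [superposition, Finset.smul_sum, ← Finset.sum_sub_distrib]
  refine Finset.sum_congr rfl fun i _ => ?_
  rw [← Nat.cast_smul_eq_nsmul ℂ, smul_smul, smul_smul, ← sub_smul]
  congr 1
  rw [← Finset.mul_sum]
  have : (√(d : ℝ))⁻¹ * (√(d : ℝ))⁻¹ = (d : ℝ)⁻¹ := by rw [← mul_inv, Real.mul_self_sqrt hd.le]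
  rw [show 2 * (∑ k, α k) / d = 2 * (∑ k, α k) * ((√(d : ℝ))⁻¹ * (√(d : ℝ))⁻¹) by
    rw [this]; rfl]
  push_cast
  ring

/-- Grover iterations marking the indices whose value exceeds `y`, followed by a query. -/
def groverCircuit (x : EuclideanSpace ℝ (Fin d)) (i : Fin d) (y : ℝ) (j : ℕ) : Circuit (Reg d) :=
  .free (prepare x i) ::
    ((List.replicate j
      [.query, .free (signFlip {r | y < r.2.2}), .queryInv, .free (diffusion x)]).flatten ++
        [.query])

theorem Circuit.eval_append {B : Type} (U : Unitary B) (c₁ c₂ : Circuit B) (ψ : StateSpace B) :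
    Circuit.eval U (c₁ ++ c₂) ψ = Circuit.eval U c₂ (Circuit.eval U c₁ ψ) := by
  induction c₁ generalizing ψ with
  | nil => rfl
  | cons g c ih => exact ih _

/-- The indices with a value larger than that of `i`. -/
def better (v : Fin d → ℝ) (i : Fin d) : Finset (Fin d) := {k | v i < v k}

theorem mem_better {v : Fin d → ℝ} {i k : Fin d} : k ∈ better v i ↔ v i < v k := by
  simp [better]

/-- The Grover angle for the indices better than `i`. -/
def groverAngle (v : Fin d → ℝ) (i : Fin d) : ℝ :=
  Real.arcsin √((better v i).card / (d : ℝ))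

theorem card_better_lt (v : Fin d → ℝ) (i : Fin d) : (better v i).card < d := by
  have h : (better v i).card < (Finset.univ : Finset (Fin d)).card :=
    Finset.card_lt_card (Finset.ssubset_univ_iff.2 fun h => by
      have := Finset.mem_univ i
      rw [← h, mem_better] at this
      exact lt_irrefl _ this)
  simpa using h

/-- The amplitudes after `j` Grover iterations that mark the indices better than `i`. -/
def groverAmplitude (v : Fin d → ℝ) (i : Fin d) (j : ℕ) (k : Fin d) : ℝ :=
  if v i < v k then Real.sin ((2 * j + 1) * groverAngle v i) / √((better v i).card : ℝ)
  else Real.cos ((2 * j + 1) * groverAngle v i) / √((d : ℝ) - (better v i).card)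

theorem sin_groverAngle (v : Fin d → ℝ) (i : Fin d) :
    Real.sin (groverAngle v i) = √((better v i).card / (d : ℝ)) := by
  refine Real.sin_arcsin ((by norm_num : (-1 : ℝ) ≤ 0).trans (Real.sqrt_nonneg _)) ?_
  rw [Real.sqrt_le_one]
  have h : ((better v i).card : ℝ) ≤ d := by exact_mod_cast (card_better_lt v i).le
  exact div_le_one_of_le₀ h (Nat.cast_nonneg _)

theorem cos_groverAngle (v : Fin d → ℝ) (i : Fin d) :
    Real.cos (groverAngle v i) = √(((d : ℝ) - (better v i).card) / (d : ℝ)) := by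
  have hd : (0 : ℝ) < d := by exact_mod_cast (Nat.zero_le _).trans_lt (card_better_lt v i)
  rw [groverAngle, Real.cos_arcsin, Real.sq_sqrt (by positivity), sub_div, div_self hd.ne']

theorem sum_better_ite (v : Fin d → ℝ) (i : Fin d) (a b : ℝ) :
    ∑ k, (if v i < v k then a else b) =
      (better v i).card * a + ((d : ℝ) - (better v i).card) * b := by
  rw [Finset.sum_ite, Finset.sum_const, Finset.sum_const, nsmul_eq_mul, nsmul_eq_mul]
  have h : (Finset.univ.filter fun k => ¬ v i < v k).card + (better v i).card = d := by
    have := Finset.card_filter_add_card_filter_not (s := (Finset.univ : Finset (Fin d)))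
      (fun k => v i < v k)
    simp only [Finset.card_univ, Fintype.card_fin] at this
    rw [better]; lia
  have h' : ((Finset.univ.filter fun k => ¬ v i < v k).card : ℝ) = d - (better v i).card := by
    rw [eq_sub_iff_add_eq]; exact_mod_cast h
  rw [h']; rfl

theorem groverAmplitude_zero (v : Fin d → ℝ) (i k : Fin d) :
    groverAmplitude v i 0 k = (√(d : ℝ))⁻¹ := by
  have hn : ((better v i).card : ℝ) < d := by exact_mod_cast card_better_lt v i
  have hn0 : (0 : ℝ) ≤ (better v i).card := Nat.cast_nonneg _
  simp only [groverAmplitude, Nat.cast_zero, mul_zero, zero_add, one_mul]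
  split_ifs with h
  · have h1 : (0 : ℝ) < (better v i).card := by
      exact_mod_cast Finset.card_pos.2 ⟨k, mem_better.2 h⟩
    have := (Real.sqrt_pos.2 h1).ne'
    rw [sin_groverAngle, Real.sqrt_div hn0]
    field_simp
  · have := (Real.sqrt_pos.2 (sub_pos.2 hn)).ne'
    rw [cos_groverAngle, Real.sqrt_div (sub_pos.2 hn).le]
    field_simp

/-- Sign flip and inversion about the mean rotate by `2θ` the plane spanned by the uniform states on
the better and on the remaining indices; what remains is the addition formulas. -/
theorem groverAmplitude_succ (v : Fin d → ℝ) (i : Fin d) (j : ℕ) (k : Fin d) :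
    2 * (∑ l, (if v i < v l then -1 else 1) * groverAmplitude v i j l) / d -
      (if v i < v k then -1 else 1) * groverAmplitude v i j k = groverAmplitude v i (j + 1) k := by
  have hn : ((better v i).card : ℝ) < d := by exact_mod_cast card_better_lt v i
  have hn0 : (0 : ℝ) ≤ (better v i).card := Nat.cast_nonneg _
  have hd : (0 : ℝ) < d := hn0.trans_lt hn
  have hang : ((2 * (j + 1 : ℕ) + 1 : ℝ)) * groverAngle v i =
      (2 * j + 1) * groverAngle v i + 2 * groverAngle v i := by push_cast; ring
  have hs := sin_groverAngle v i
  have hc := cos_groverAngle v i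
  rw [Real.sqrt_div hn0] at hs
  rw [Real.sqrt_div (sub_pos.2 hn).le] at hc
  simp only [groverAmplitude, hang, Real.sin_add, Real.cos_add, Real.sin_two_mul,
    Real.cos_two_mul, hs, hc]
  generalize Real.sin ((2 * j + 1) * groverAngle v i) = s
  generalize Real.cos ((2 * j + 1) * groverAngle v i) = c
  have hsum : ∑ l, (if v i < v l then (-1 : ℝ) else 1) *
      (if v i < v l then s / √((better v i).card : ℝ)
        else c / √((d : ℝ) - (better v i).card)) =
      √((d : ℝ) - (better v i).card) * c - √((better v i).card : ℝ) * s := by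
    rw [← Finset.sum_congr rfl fun l _ => show (if v i < v l then
      -(s / √((better v i).card : ℝ)) else c / √((d : ℝ) - (better v i).card)) = _ by
        split_ifs <;> ring, sum_better_ite]
    -- `a / √a = √a` also holds at `a = 0`, so having no better index is not a separate case.
    have h1 := Real.div_sqrt (x := ((better v i).card : ℝ))
    have h2 := Real.div_sqrt (x := (d : ℝ) - (better v i).card)
    linear_combination c * h2 - s * h1
  rw [hsum]
  have hp := Real.sq_sqrt hn0
  have hq := Real.sq_sqrt (sub_pos.2 hn).le
  have hr := Real.sq_sqrt hd.le
  have hr0 := (Real.sqrt_pos.2 hd).ne'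
  have hq0 := (Real.sqrt_pos.2 (sub_pos.2 hn)).ne'
  set p := √((better v i).card : ℝ)
  set q := √((d : ℝ) - (better v i).card)
  set r := √(d : ℝ)
  have hpq : p ^ 2 + q ^ 2 = r ^ 2 := by rw [hp, hq, hr]; ring
  rw [← hr]
  split_ifs with h
  · have hp0 : p ≠ 0 := by
      refine (Real.sqrt_pos.2 ?_).ne'
      exact_mod_cast Finset.card_pos.2 ⟨k, mem_better.2 h⟩
    field_simp
    linear_combination -2 * s * hpq
  · field_simp
    ring

theorem grover_iterations [NeZero d] (v : EuclideanSpace ℝ (Fin d) → Fin d → ℝ)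
    (x : EuclideanSpace ℝ (Fin d)) (i : Fin d) (j m : ℕ) :
    Circuit.eval (valueOracle v) (List.replicate j
      [.query, .free (signFlip {r | v x i < r.2.2}), .queryInv, .free (diffusion x)]).flatten
        (superposition x 0 (groverAmplitude (v x) i m)) =
      superposition x 0 (groverAmplitude (v x) i (m + j)) := by
  classical
  induction j generalizing m with
  | zero => rfl
  | succ j ih =>
    rw [List.replicate_succ, List.flatten_cons, Circuit.eval_append]
    have h : Circuit.eval (valueOracle v)
        [.query, .free (signFlip {r | v x i < r.2.2}), .queryInv, .free (diffusion x)]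
        (superposition x 0 (groverAmplitude (v x) i m)) =
        superposition x 0 (groverAmplitude (v x) i (m + 1)) := by
      change diffusion x ((valueOracle v).symm (signFlip _ (valueOracle v _))) = _
      rw [valueOracle_superposition, signFlip_superposition, valueOracle_symm_superposition]
      simp only [Pi.zero_apply, zero_add, sub_self, Set.mem_ofPred_eq]
      refine (diffusion_superposition x _).trans ?_
      congr 1
      funext k
      exact groverAmplitude_succ (v x) i m k
    rw [h, ih, Nat.add_right_comm, Nat.add_assoc]

/-- The closing query writes the value next to the index, so a measurement yields the new threshold
without a further call. -/
theorem groverCircuit_ket [NeZero d] (v : EuclideanSpace ℝ (Fin d) → Fin d → ℝ)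
    (x : EuclideanSpace ℝ (Fin d)) (i : Fin d) (j : ℕ) :
    Circuit.eval (valueOracle v) (groverCircuit x i (v x i) j) (ket (i, x, 0)) =
      superposition x (v x) (groverAmplitude (v x) i j) := by
  change Circuit.eval _ (_ ++ _) (prepare x i _) = _
  have h0 : uniformState x = superposition x 0 (groverAmplitude (v x) i 0) := by
    rw [uniformState]; congr 1; funext k; exact (groverAmplitude_zero (v x) i k).symm
  rw [prepare_ket, h0, Circuit.eval_append, grover_iterations, zero_add]
  change valueOracle v _ = _
  rw [valueOracle_superposition]
  simp

/-! ### Iterated Grover search with a classical threshold -/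

/-- Starting from the index `i` with value `y`, run Grover searches for a larger value with the
given numbers of iterations, moving to the index found whenever its value is larger. -/
def search {d : ℕ} (x : EuclideanSpace ℝ (Fin d)) :
    List ℕ → Fin d → ℝ → Program (Reg d) (Fin d)
  | [], i, _ => .output i
  | j :: js, i, y => .run (i, x, 0) (groverCircuit x i y j) fun r =>
      open Classical in if y < r.2.2 then search x js r.1 r.2.2 else search x js i y

/-- The expectation of `g` at the index reached by the searches with iteration numbers `js`. -/
def expectation {d : ℕ} (v : Fin d → ℝ) : List ℕ → (Fin d → ℝ) → Fin d → ℝ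
  | [], g, i => g i
  | j :: js, g, i =>
      Real.cos ((2 * j + 1) * groverAngle v i) ^ 2 * expectation v js g i +
        Real.sin ((2 * j + 1) * groverAngle v i) ^ 2 / (better v i).card *
          ∑ k ∈ better v i, expectation v js g k

/-- The number of indices better than a given one. -/
def numBetter {d : ℕ} (v : Fin d → ℝ) (i : Fin d) : ℝ := (better v i).card

theorem div_mul_self_le {a : ℝ} (ha : 0 ≤ a) (b : ℝ) : a / b * b ≤ a := by
  rcases eq_or_ne b 0 with rfl | hb
  · simpa using ha
  · exact (div_mul_cancel₀ a hb).le

/-- The conditional index is the update rule of `search`; this identifies one measured round with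
one unfolding of `expectation`. -/
theorem sum_groverAmplitude_sq_mul (v h : Fin d → ℝ) (i : Fin d) (j : ℕ) :
    ∑ k, groverAmplitude v i j k ^ 2 * h (if v i < v k then k else i) =
      Real.cos ((2 * j + 1) * groverAngle v i) ^ 2 * h i +
        Real.sin ((2 * j + 1) * groverAngle v i) ^ 2 / (better v i).card *
          ∑ k ∈ better v i, h k := by
  have hn : ((better v i).card : ℝ) < d := by exact_mod_cast card_better_lt v i
  have hn0 : (0 : ℝ) ≤ (better v i).card := Nat.cast_nonneg _
  set c := Real.cos ((2 * j + 1) * groverAngle v i)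
  set s := Real.sin ((2 * j + 1) * groverAngle v i)
  have h1 : ∀ k, groverAmplitude v i j k ^ 2 * h (if v i < v k then k else i) =
      (if v i < v k then s ^ 2 / (better v i).card * h k else 0) +
        (if v i < v k then 0 else c ^ 2 / ((d : ℝ) - (better v i).card) * h i) := by
    intro k
    rw [groverAmplitude]
    split_ifs
    · rw [div_pow, Real.sq_sqrt hn0, add_zero]
    · rw [div_pow, Real.sq_sqrt (sub_pos.2 hn).le, zero_add]
  simp only [h1, Finset.sum_add_distrib, sum_better_ite]
  rw [← Finset.sum_filter, ← Finset.mul_sum, mul_zero, zero_add, ← mul_assoc,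
    mul_div_cancel₀ _ (sub_pos.2 hn).ne', add_comm]
  rfl

theorem expectation_append (v : Fin d → ℝ) (js ks : List ℕ) (g : Fin d → ℝ) :
    expectation v (js ++ ks) g = expectation v js (expectation v ks g) := by
  induction js with
  | nil => rfl
  | cons j js ih => funext i; simp only [List.cons_append, expectation, ih]

theorem expectation_mono (v : Fin d → ℝ) (js : List ℕ) {g h : Fin d → ℝ} (hgh : g ≤ h) :
    expectation v js g ≤ expectation v js h := by
  induction js with
  | nil => exact hgh
  | cons j js ih =>
    intro i
    simp only [expectation]
    gcongr with k _
    · exact ih i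
    · exact ih k

/-- The linear part passes through exactly. For the constant only a total weight of at most one is
used, whence `max b 0`. -/
theorem expectation_affine (v : Fin d → ℝ) (js : List ℕ) (a b : ℝ) (g : Fin d → ℝ) (i : Fin d) :
    expectation v js (fun k => a * g k + b) i ≤ a * expectation v js g i + max b 0 := by
  induction js generalizing i with
  | nil => exact add_le_add_right (le_max_left _ _) _
  | cons j js ih =>
    simp only [expectation]
    have hs : Real.sin ((2 * j + 1) * groverAngle v i) ^ 2 / (better v i).card *
        ∑ k ∈ better v i, (a * expectation v js g k + max b 0) ≤
        a * (Real.sin ((2 * j + 1) * groverAngle v i) ^ 2 / (better v i).card *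
          ∑ k ∈ better v i, expectation v js g k) +
        Real.sin ((2 * j + 1) * groverAngle v i) ^ 2 * max b 0 := by
      rw [Finset.sum_add_distrib, ← Finset.mul_sum, Finset.sum_const, nsmul_eq_mul, mul_add]
      refine add_le_add (le_of_eq (by ring)) ?_
      rw [← mul_assoc]
      refine mul_le_mul_of_nonneg_right ?_ (le_max_right _ _)
      exact div_mul_self_le (sq_nonneg _) _
    calc _ ≤ Real.cos ((2 * j + 1) * groverAngle v i) ^ 2 *
            (a * expectation v js g i + max b 0) +
          Real.sin ((2 * j + 1) * groverAngle v i) ^ 2 / (better v i).card *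
            ∑ k ∈ better v i, (a * expectation v js g k + max b 0) := by
          gcongr with k _
          · exact ih i
          · exact ih k
      _ ≤ _ := by
          have := Real.sin_sq_add_cos_sq ((2 * j + 1) * groverAngle v i)
          linear_combination hs + max b 0 * this

theorem expectation_nonneg (v : Fin d → ℝ) (js : List ℕ) {g : Fin d → ℝ} (hg : 0 ≤ g) :
    0 ≤ expectation v js g := by
  induction js with
  | nil => exact hg
  | cons j js ih =>
    intro i
    have h2 : ∀ k, 0 ≤ expectation v js g k := ih
    have h3 := Finset.sum_nonneg fun k (_ : k ∈ better v i) => h2 k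
    have := h2 i
    simp only [expectation, Pi.zero_apply]
    positivity

theorem numBetter_nonneg (v : Fin d → ℝ) : 0 ≤ numBetter v := fun _ => Nat.cast_nonneg _

/-- The searches fail to find a maximum with probability at most the expected number of indices
that are better than the final one. -/
theorem search_failure_le [NeZero d] (v : EuclideanSpace ℝ (Fin d) → Fin d → ℝ)
    (x : EuclideanSpace ℝ (Fin d)) (js : List ℕ) (i : Fin d) :
    ((search x js i (v x i)).dist (valueOracle v)).toOuterMeasure {k | ∀ j, v x j ≤ v x k}ᶜ ≤
      ENNReal.ofReal (expectation (v x) js (numBetter (v x)) i) := by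
  induction js generalizing i with
  | nil =>
    simp only [search, Program.dist, expectation, numBetter, PMF.toOuterMeasure_pure_apply]
    split_ifs with h
    · simp only [Set.mem_compl_iff, Set.mem_ofPred_eq, not_forall, not_le] at h
      obtain ⟨k, hk⟩ := h
      -- Markov's inequality in integer form: at a non-maximal index the count is at least one.
      have : 1 ≤ (better (v x) i).card := Finset.card_pos.2 ⟨k, mem_better.2 hk⟩
      simpa using this
    · exact zero_le
  | cons j js ih =>
    simp only [search, Program.dist]
    rw [measure_bind_superposition x (v x) _ _ (groverCircuit_ket v x i j), expectation,
      ← sum_groverAmplitude_sq_mul, ENNReal.ofReal_sum_of_nonneg]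
    · refine Finset.sum_le_sum fun k _ => ?_
      rw [ENNReal.ofReal_mul (sq_nonneg _)]
      gcongr
      dsimp only
      split_ifs with h
      · exact ih k
      · exact ih i
    · exact fun k _ => mul_nonneg (sq_nonneg _)
        (expectation_nonneg _ _ (numBetter_nonneg _) _)

/-! ### The number of better indices decreases -/

/-- Of the two orders of a pair of better indices at most one is strictly increasing, so at most
half of all ordered pairs are counted. -/
theorem sum_numBetter_le (v : Fin d → ℝ) (i : Fin d) :
    2 * ∑ k ∈ better v i, numBetter v k ≤ numBetter v i ^ 2 := by
  have h : ∀ k ∈ better v i, numBetter v k =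
      ∑ l ∈ better v i, if v k < v l then (1 : ℝ) else 0 := by
    intro k hk
    rw [Finset.sum_boole, numBetter]
    congr 2
    ext l
    simp only [mem_better, Finset.mem_filter] at hk ⊢
    exact ⟨fun h => ⟨hk.trans h, h⟩, fun h => h.2⟩
  rw [Finset.sum_congr rfl h, two_mul]
  nth_rw 2 [Finset.sum_comm]
  simp only [← Finset.sum_add_distrib]
  calc _ ≤ ∑ k ∈ better v i, ∑ l ∈ better v i, (1 : ℝ) := by
        refine Finset.sum_le_sum fun k _ => Finset.sum_le_sum fun l _ => ?_
        split_ifs with h1 h2 <;> norm_num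
        exact absurd h1 h2.asymm
    _ = _ := by simp [numBetter, sq]

theorem expectation_cons_le (v : Fin d → ℝ) (j : ℕ) {g : Fin d → ℝ} (hg : g ≤ numBetter v)
    (i : Fin d) :
    Real.cos ((2 * j + 1) * groverAngle v i) ^ 2 * g i +
        Real.sin ((2 * j + 1) * groverAngle v i) ^ 2 / (better v i).card *
          ∑ k ∈ better v i, g k ≤
      Real.cos ((2 * j + 1) * groverAngle v i) ^ 2 * g i +
        Real.sin ((2 * j + 1) * groverAngle v i) ^ 2 * (numBetter v i / 2) := by
  have h1 := sum_numBetter_le v i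
  have h2 : ∑ k ∈ better v i, g k ≤ numBetter v i * (numBetter v i / 2) := by
    have := Finset.sum_le_sum fun k (_ : k ∈ better v i) => hg k
    linarith
  have hn := numBetter_nonneg v i
  change 0 ≤ numBetter v i at hn
  refine add_le_add_right ?_ _
  calc _ ≤ Real.sin ((2 * j + 1) * groverAngle v i) ^ 2 / numBetter v i *
        (numBetter v i * (numBetter v i / 2)) := by
        exact mul_le_mul_of_nonneg_left h2 (div_nonneg (sq_nonneg _) hn)
    _ ≤ _ := by
      rw [← mul_assoc]
      refine mul_le_mul_of_nonneg_right ?_ (by positivity)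
      exact div_mul_self_le (sq_nonneg _) _

theorem expectation_numBetter_le (v : Fin d → ℝ) (js : List ℕ) :
    expectation v js (numBetter v) ≤ numBetter v := by
  induction js with
  | nil => exact le_rfl
  | cons j js ih =>
    intro i
    refine (expectation_cons_le v j ih i).trans ?_
    have h := ih i
    have hn := numBetter_nonneg v i
    change 0 ≤ numBetter v i at hn
    have := Real.sin_sq_add_cos_sq ((2 * j + 1) * groverAngle v i)
    nlinarith [sq_nonneg (Real.sin ((2 * j + 1) * groverAngle v i)),
      sq_nonneg (Real.cos ((2 * j + 1) * groverAngle v i))]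

/-- One good search suffices: `cos² + sin² / 2 = 1 - sin² / 2 ≤ 7 / 8`. If the good one comes later,
moving already halves the count on average and staying is covered by induction. -/
theorem expectation_numBetter_le_of_sin (v : Fin d → ℝ) (js : List ℕ) (i : Fin d)
    (h : ∃ j ∈ js, 1 / 4 ≤ Real.sin ((2 * j + 1) * groverAngle v i) ^ 2) :
    expectation v js (numBetter v) i ≤ 7 / 8 * numBetter v i := by
  induction js with
  | nil => simp at h
  | cons j js ih =>
    refine (expectation_cons_le v j (expectation_numBetter_le v js) i).trans ?_
    have hn := numBetter_nonneg v i
    change 0 ≤ numBetter v i at hn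
    have h1 := Real.sin_sq_add_cos_sq ((2 * j + 1) * groverAngle v i)
    have hc := sq_nonneg (Real.cos ((2 * j + 1) * groverAngle v i))
    have hs := sq_nonneg (Real.sin ((2 * j + 1) * groverAngle v i))
    have hle := expectation_numBetter_le v js i
    rcases le_or_gt (1 / 4) (Real.sin ((2 * j + 1) * groverAngle v i) ^ 2) with hj | hj
    · nlinarith
    · have hi : expectation v js (numBetter v) i ≤ 7 / 8 * numBetter v i := by
        refine ih ?_
        obtain ⟨k, hk, hk2⟩ := h
        rcases List.mem_cons.1 hk with rfl | hk
        · exact absurd hk2 hj.not_ge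
        · exact ⟨k, hk, hk2⟩
      nlinarith

/-! ### The schedule of iteration numbers -/

/-- The iteration numbers `(3 ^ k - 1) / 2` for `k ≤ s`; the Grover rotation with `(3 ^ k - 1) / 2`
iterations multiplies the angle by `3 ^ k`. -/
def stage (s : ℕ) : List ℕ := (List.range (s + 1)).map fun k => (3 ^ k - 1) / 2

/-- The schedule that runs through 22 copies of each stage below `s`. -/
def warmup : ℕ → List ℕ
  | 0 => []
  | s + 1 => warmup s ++ (List.replicate 22 (stage s)).flatten

/-- The schedule for `d` values and failure probability `δ`. -/
def schedule (d : ℕ) (δ : ℝ) : List ℕ :=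
  warmup (Nat.clog 9 d) ++
    (List.replicate ⌈8 * Real.log (144 / δ)⌉₊ (stage (Nat.clog 9 d))).flatten

theorem two_mul_stage_add_one (k : ℕ) : 2 * ((3 ^ k - 1) / 2) + 1 = 3 ^ k := by
  have : 3 ^ k % 2 = 1 := by rw [Nat.pow_mod]; simp
  lia

/-- The ends of `[π/6, π/2]` have ratio three, so repeated tripling from below cannot jump over the
interval. -/
theorem exists_three_pow_mul_mem {θ : ℝ} (s : ℕ) (h1 : Real.pi / 2 / 3 ^ (s + 1) ≤ θ)
    (h2 : θ ≤ Real.pi / 2) :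
    ∃ k ≤ s, Real.pi / 6 ≤ 3 ^ k * θ ∧ 3 ^ k * θ ≤ Real.pi / 2 := by
  induction s generalizing θ with
  | zero => exact ⟨0, le_rfl, by norm_num at h1 ⊢; linarith, by simpa using h2⟩
  | succ s ih =>
    rcases le_or_gt (Real.pi / 6) θ with h | h
    · exact ⟨0, by lia, by simpa using h, by simpa using h2⟩
    · obtain ⟨k, hk, h3, h4⟩ := ih (θ := 3 * θ)
        (by rw [pow_succ, ← div_div, div_le_iff₀ (by norm_num)] at h1; linarith) (by linarith)
      exact ⟨k + 1, by lia, by rw [pow_succ, mul_assoc]; exact h3,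
        by rw [pow_succ, mul_assoc]; exact h4⟩

theorem numBetter_eq_sin_sq (v : Fin d → ℝ) (i : Fin d) :
    numBetter v i = d * Real.sin (groverAngle v i) ^ 2 := by
  have hd : (0 : ℝ) < d := by exact_mod_cast (Nat.zero_le _).trans_lt (card_better_lt v i)
  rw [sin_groverAngle, Real.sq_sqrt (by positivity), mul_div_cancel₀ _ hd.ne', numBetter]

/-- The threshold on the count says `sin θ ≥ 1 / 3 ^ s`, hence `θ ≥ 1 / 3 ^ s`, large enough for
tripling to reach `[π/6, π/2]`, where `sin² ≥ 1 / 4`. -/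
theorem expectation_stage_le_of_le (v : Fin d → ℝ) (s : ℕ) (i : Fin d)
    (h : (d : ℝ) / 9 ^ s ≤ numBetter v i) :
    expectation v (stage s) (numBetter v) i ≤ 7 / 8 * numBetter v i := by
  have hd : (0 : ℝ) < d := by exact_mod_cast (Nat.zero_le _).trans_lt (card_better_lt v i)
  have hθ0 : 0 ≤ groverAngle v i := Real.arcsin_nonneg.2 (Real.sqrt_nonneg _)
  have hθ : Real.pi / 2 / 3 ^ (s + 1) ≤ groverAngle v i := by
    by_contra! hlt
    have h2 : Real.pi / 2 / 3 ^ (s + 1) ≤ 1 / 3 ^ s := by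
      rw [pow_succ, ← div_div, div_right_comm]
      gcongr
      linarith [Real.pi_le_four]
    have hsin := Real.sin_le hθ0
    have hsin0 := Real.sin_nonneg_of_nonneg_of_le_pi hθ0
      ((Real.arcsin_le_pi_div_two _).trans (by linarith [Real.pi_pos]))
    have h3 : Real.sin (groverAngle v i) ^ 2 < (1 / 3 ^ s) ^ 2 :=
      pow_lt_pow_left₀ (hsin.trans_lt (hlt.trans_le h2)) hsin0 two_ne_zero
    have h4 : ((1 : ℝ) / 3 ^ s) ^ 2 = 1 / 9 ^ s := by
      rw [div_pow, one_pow, ← pow_mul, mul_comm s 2, pow_mul]; norm_num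
    rw [h4] at h3
    rw [numBetter_eq_sin_sq, div_eq_mul_one_div] at h
    exact absurd (le_of_mul_le_mul_left h hd) h3.not_ge
  obtain ⟨k, hk, h1, h2⟩ := exists_three_pow_mul_mem s hθ (Real.arcsin_le_pi_div_two _)
  refine expectation_numBetter_le_of_sin v _ i
    ⟨(3 ^ k - 1) / 2, List.mem_map.2 ⟨k, by simp; lia, rfl⟩, ?_⟩
  have h3 : (2 * ((3 ^ k - 1) / 2 : ℕ) + 1 : ℝ) = 3 ^ k := by
    exact_mod_cast two_mul_stage_add_one k
  rw [h3]
  have h4 : Real.sin (Real.pi / 6) ≤ Real.sin (3 ^ k * groverAngle v i) :=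
    Real.sin_le_sin_of_le_of_le_pi_div_two (by linarith [Real.pi_pos]) h2 h1
  rw [Real.sin_pi_div_six] at h4
  nlinarith

/-- Below the threshold a stage may achieve nothing, but the count is then itself at most the
additive term. -/
theorem expectation_stage_le (v : Fin d → ℝ) (s : ℕ) (i : Fin d) :
    expectation v (stage s) (numBetter v) i ≤ 7 / 8 * numBetter v i + d / 9 ^ s := by
  have hn : 0 ≤ numBetter v i := numBetter_nonneg v i
  rcases le_total ((d : ℝ) / 9 ^ s) (numBetter v i) with h | h
  · have := expectation_stage_le_of_le v s i h
    have : (0 : ℝ) ≤ d / 9 ^ s := by positivity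
    linarith
  · have := expectation_numBetter_le v (stage s) i
    linarith

/-- The count is an integer: it is zero, or at least `1 ≥ d / 9 ^ s`, so no additive error remains.
-/
theorem expectation_stage_le_of_large (v : Fin d → ℝ) {s : ℕ} (hs : d ≤ 9 ^ s) (i : Fin d) :
    expectation v (stage s) (numBetter v) i ≤ 7 / 8 * numBetter v i + 0 := by
  rw [add_zero]
  rcases Nat.eq_zero_or_pos (better v i).card with h | h
  · refine (expectation_numBetter_le v (stage s) i).trans ?_
    simp [numBetter, h]
  · refine expectation_stage_le_of_le v s i ?_
    refine (div_le_one_of_le₀ (by exact_mod_cast hs) (by positivity)).trans ?_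
    simpa [numBetter] using h

/-- The map `n ↦ 7 / 8 * n + b` has fixed point `8 * b`. -/
theorem expectation_replicate_le (v : Fin d → ℝ) (js : List ℕ) {b : ℝ} (hb : 0 ≤ b)
    (h : ∀ i, expectation v js (numBetter v) i ≤ 7 / 8 * numBetter v i + b) (m : ℕ) (i : Fin d) :
    expectation v (List.replicate m js).flatten (numBetter v) i ≤
      (7 / 8) ^ m * numBetter v i + 8 * b * (1 - (7 / 8) ^ m) := by
  induction m generalizing i with
  | zero => simp [expectation]
  | succ m ih =>
    rw [List.replicate_succ, List.flatten_cons, expectation_append]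
    have hb' : 0 ≤ 8 * b * (1 - (7 / 8 : ℝ) ^ m) :=
      mul_nonneg (by positivity) (sub_nonneg.2 (pow_le_one₀ (by norm_num) (by norm_num)))
    have h1 := expectation_mono v js (fun k => ih k) i
    have h2 := expectation_affine v js ((7 / 8) ^ m) (8 * b * (1 - (7 / 8) ^ m)) (numBetter v) i
    rw [max_eq_left hb'] at h2
    have h3 := mul_le_mul_of_nonneg_left (h i) (by positivity : (0 : ℝ) ≤ (7 / 8) ^ m)
    rw [pow_succ]
    linarith

theorem numBetter_le (v : Fin d → ℝ) (i : Fin d) : numBetter v i ≤ d := by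
  simpa [numBetter] using (card_better_lt v i).le

/-- The numbers 22 and 144 fit together: `(7 / 8) ^ 22 ≤ 1 / 18`, and `144 / 18 + 8 = 144 / 9`
reproduces the bound at the next threshold. -/
theorem expectation_warmup_le (v : Fin d → ℝ) (s : ℕ) (i : Fin d) :
    expectation v (warmup s) (numBetter v) i ≤ 144 * (d / 9 ^ s) := by
  induction s generalizing i with
  | zero =>
    have := numBetter_le v i
    have hd : (0 : ℝ) ≤ d := Nat.cast_nonneg d
    simp only [warmup, expectation, pow_zero, div_one]
    linarith
  | succ s ih =>
    have hb : (0 : ℝ) ≤ d / 9 ^ s := by positivity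
    have h1 : ∀ k, expectation v (List.replicate 22 (stage s)).flatten (numBetter v) k ≤
        1 / 18 * numBetter v k + 8 * (d / 9 ^ s) := by
      intro k
      refine (expectation_replicate_le v (stage s) hb (expectation_stage_le v s) 22 k).trans ?_
      have hn : 0 ≤ numBetter v k := numBetter_nonneg v k
      refine add_le_add (mul_le_mul_of_nonneg_right (by norm_num) hn) ?_
      exact mul_le_of_le_one_right (by positivity) (by norm_num)
    rw [warmup, expectation_append]
    have h2 := expectation_mono v (warmup s) (fun k => h1 k) i
    have h3 := expectation_affine v (warmup s) (1 / 18) (8 * (d / 9 ^ s)) (numBetter v) i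
    rw [max_eq_left (by positivity)] at h3
    have h4 := ih i
    rw [pow_succ, ← div_div]
    linarith

theorem pow_seven_eighths_le {δ : ℝ} (hδ : 0 < δ) :
    144 * (7 / 8 : ℝ) ^ ⌈8 * Real.log (144 / δ)⌉₊ ≤ δ := by
  set l := ⌈8 * Real.log (144 / δ)⌉₊
  have hl : 8 * Real.log (144 / δ) ≤ l := Nat.le_ceil _
  have h1 : (7 / 8 : ℝ) ≤ Real.exp (-(1 / 8)) := by
    have := Real.add_one_le_exp (-(1 / 8 : ℝ))
    linarith
  have h2 : (7 / 8 : ℝ) ^ l ≤ Real.exp (-Real.log (144 / δ)) := by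
    refine (pow_le_pow_left₀ (by norm_num) h1 l).trans ?_
    rw [← Real.exp_nat_mul]
    exact Real.exp_le_exp.2 (by linarith)
  rw [Real.exp_neg, Real.exp_log (by positivity), inv_div] at h2
  linarith

/-- The warm-up leaves an expected count of at most 144 instead of `d`, so the number of final
copies depends on `δ` alone and no `log d` enters. -/
theorem expectation_schedule_le (v : Fin d → ℝ) {δ : ℝ} (hδ : 0 < δ) (i : Fin d) :
    expectation v (schedule d δ) (numBetter v) i ≤ δ := by
  have hS : d ≤ 9 ^ Nat.clog 9 d := Nat.le_pow_clog (by norm_num) d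
  rw [schedule, expectation_append]
  set l := ⌈8 * Real.log (144 / δ)⌉₊
  set S := Nat.clog 9 d
  have h1 := expectation_mono v (warmup S)
    (fun k => expectation_replicate_le v (stage S) le_rfl (expectation_stage_le_of_large v hS) l k) i
  have h2 := expectation_affine v (warmup S) ((7 / 8) ^ l) (8 * 0 * (1 - (7 / 8) ^ l))
    (numBetter v) i
  simp only [mul_zero, zero_mul, max_self, add_zero] at h1 h2
  have h3 : (d : ℝ) / 9 ^ S ≤ 1 := div_le_one_of_le₀ (by exact_mod_cast hS) (by positivity)
  have h4 := expectation_warmup_le v S i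
  have h5 : (7 / 8 : ℝ) ^ l * expectation v (warmup S) (numBetter v) i ≤ (7 / 8) ^ l * 144 :=
    mul_le_mul_of_nonneg_left (by linarith) (by positivity)
  have h6 := pow_seven_eighths_le hδ
  linarith

/-! ### Quantum maximum finding -/

/-- Quantum maximum finding: query the value of the index `0`, then search for larger values. -/
def maxFinder (d : ℕ) [NeZero d] (δ : ℝ) : IndexFinder d := fun x =>
  .run (0, x, 0) [.query] fun r => search x (schedule d δ) r.1 r.2.2

theorem toOuterMeasure_add_compl {α : Type*} (p : PMF α) (s : Set α) :
    p.toOuterMeasure s + p.toOuterMeasure sᶜ = 1 := by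
  rw [PMF.toOuterMeasure_apply, PMF.toOuterMeasure_apply, ← ENNReal.tsum_add, ← p.tsum_coe]
  exact tsum_congr fun a => congrFun (Set.indicator_self_add_compl s p) a

theorem isMaxFinding_maxFinder (d : ℕ) [NeZero d] {δ : ℝ} (hδ : 0 < δ) :
    IsMaxFinding (maxFinder d δ) δ := by
  intro v x
  have hq : Circuit.eval (valueOracle v) [.query] (ket ((0 : Fin d), x, (0 : ℝ))) =
      superposition x (v x) (Pi.single 0 1) := by
    rw [ket_eq_superposition]
    change valueOracle v _ = _
    simp [valueOracle_superposition]
  have hfail : ((maxFinder d δ x).dist (valueOracle v)).toOuterMeasure {k | ∀ j, v x j ≤ v x k}ᶜ ≤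
      ENNReal.ofReal δ := by
    rw [maxFinder, Program.dist, measure_bind_superposition x (v x) _ _ hq,
      Finset.sum_eq_single 0]
    · simp only [Pi.single_eq_same, one_pow, ENNReal.ofReal_one, one_mul]
      exact (search_failure_le v x _ 0).trans
        (ENNReal.ofReal_le_ofReal (expectation_schedule_le (v x) hδ 0))
    · intro i _ hi
      simp [hi]
    · simp
  rw [ENNReal.ofReal_sub 1 hδ.le, ENNReal.ofReal_one, tsub_le_iff_right,
    ← toOuterMeasure_add_compl _ {k | ∀ j, v x j ≤ v x k}]
  gcongr

/-! ### Query complexity -/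

theorem queries_append {B : Type} (c₁ c₂ : Circuit B) :
    Circuit.queries (c₁ ++ c₂) = Circuit.queries c₁ + Circuit.queries c₂ := by
  simp [Circuit.queries]

theorem queries_groverCircuit (x : EuclideanSpace ℝ (Fin d)) (i : Fin d) (y : ℝ) (j : ℕ) :
    Circuit.queries (groverCircuit x i y j) = 2 * j + 1 := by
  simp [groverCircuit, Circuit.queries, Gate.queries, mul_comm]

theorem queries_search_le (x : EuclideanSpace ℝ (Fin d)) (js : List ℕ) (i : Fin d) (y : ℝ) :
    (search x js i y).queries ≤ ((js.map fun j => 2 * j + 1).sum : ℕ) := by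
  induction js generalizing i y with
  | nil => simp [search, Program.queries]
  | cons j js ih =>
    rw [search, Program.queries, queries_groverCircuit, List.map_cons, List.sum_cons]
    push_cast
    gcongr
    refine iSup_le fun r => ?_
    split_ifs
    · exact_mod_cast ih _ _
    · exact_mod_cast ih _ _

theorem sum_stage_le (s : ℕ) : 2 * ((stage s).map fun j => 2 * j + 1).sum ≤ 3 ^ (s + 1) := by
  simp only [stage, List.map_map, Function.comp_def, two_mul_stage_add_one]
  induction s with
  | zero => simp
  | succ s ih =>
    rw [List.range_succ, List.map_append, List.sum_append, List.map_singleton, List.sum_singleton]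
    rw [pow_succ 3 (s + 1)]
    lia

theorem sum_map_replicate_flatten (js : List ℕ) (f : ℕ → ℕ) (m : ℕ) :
    ((List.replicate m js).flatten.map f).sum = m * (js.map f).sum := by
  simp [List.map_flatten, List.sum_flatten]

/-- The last stages dominate; the constant closes because `17 + 22 * (3 / 2) = 50 ≤ 3 * 17`. -/
theorem sum_warmup_le (s : ℕ) : ((warmup s).map fun j => 2 * j + 1).sum ≤ 17 * 3 ^ s := by
  induction s with
  | zero => simp [warmup]
  | succ s ih =>
    rw [warmup, List.map_append, List.sum_append, sum_map_replicate_flatten]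
    have := sum_stage_le s
    rw [pow_succ] at this ⊢
    lia

theorem three_pow_clog_le (hd : d ≠ 0) : (3 : ℝ) ^ Nat.clog 9 d ≤ 3 * √(d : ℝ) := by
  have h : (9 : ℝ) ^ Nat.clog 9 d ≤ 9 * d := by
    rcases Nat.lt_or_ge 1 d with h1 | h1
    · have h2 := (Nat.pow_pred_clog_lt_self (b := 9) (by norm_num) h1).le
      have h3 : 0 < Nat.clog 9 d := Nat.clog_pos (by norm_num) h1
      obtain ⟨m, hm⟩ := Nat.exists_eq_succ_of_ne_zero h3.ne'
      rw [hm] at h2 ⊢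
      rw [pow_succ, mul_comm]
      have : (9 : ℝ) ^ m ≤ d := by exact_mod_cast h2
      linarith
    · have h2 : d = 1 := by lia
      subst h2
      simp
  have h9 : (9 : ℝ) ^ Nat.clog 9 d = (3 ^ Nat.clog 9 d) ^ 2 := by
    rw [← pow_mul, mul_comm, pow_mul]; norm_num
  refine le_of_sq_le_sq ?_ (by positivity)
  rw [mul_pow, Real.sq_sqrt (Nat.cast_nonneg d), ← h9]
  linarith

/-- The number of queries of maximum finding is `O(√d log (1 / δ))`. -/
theorem queries_maxFinder_le (d : ℕ) [NeZero d] (δ : ℝ) (x : EuclideanSpace ℝ (Fin d)) :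
    ∃ n : ℕ, (maxFinder d δ x).queries ≤ n ∧
      (n : ℝ) ≤ √(d : ℝ) * (54 + 9 / 2 * ⌈8 * Real.log (144 / δ)⌉₊) := by
  refine ⟨1 + ((schedule d δ).map fun j => 2 * j + 1).sum, ?_, ?_⟩
  · rw [maxFinder, Program.queries]
    push_cast
    refine add_le_add (le_of_eq rfl) (iSup_le fun r => ?_)
    exact_mod_cast queries_search_le _ _ _ _
  · rw [schedule, List.map_append, List.sum_append, sum_map_replicate_flatten]
    have h1 := sum_warmup_le (Nat.clog 9 d)
    have h2 := sum_stage_le (Nat.clog 9 d)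
    have h3 := three_pow_clog_le (NeZero.ne d)
    set l := ⌈8 * Real.log (144 / δ)⌉₊
    set S := Nat.clog 9 d
    -- This absorbs the initial query: `1 + 17 * 3 ^ S ≤ 18 * 3 ^ S ≤ 54 * √d`.
    have h4 : (1 : ℝ) ≤ 3 ^ S := one_le_pow₀ (by norm_num)
    have h1' : ((((warmup S).map fun j => 2 * j + 1).sum : ℕ) : ℝ) ≤ 17 * 3 ^ S := by
      exact_mod_cast h1
    have h2' : 2 * ((((stage S).map fun j => 2 * j + 1).sum : ℕ) : ℝ) ≤ 3 * 3 ^ S := by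
      rw [pow_succ, mul_comm (3 ^ S)] at h2; exact_mod_cast h2
    push_cast at h1' h2' ⊢
    have hl : (0 : ℝ) ≤ l := Nat.cast_nonneg l
    nlinarith [mul_le_mul_of_nonneg_left h2' hl, mul_le_mul_of_nonneg_left h3 hl]

/-! ### Replacing oracle calls by circuits -/

theorem eval_inv {B : Type} (U : Unitary B) (c : Circuit B) :
    Circuit.eval U (Circuit.inv c) = (Circuit.eval U c).symm := by
  induction c with
  | nil => rfl
  | cons g c ih =>
    ext1 ψ
    have h : Circuit.inv (g :: c) = Circuit.inv c ++ [g.inv] := by simp [Circuit.inv]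
    rw [h, Circuit.eval_append, ih]
    cases g <;> rfl

theorem eval_expand {B : Type} (U : Unitary B) (G c : Circuit B) :
    Circuit.eval U (Circuit.expand G c) = Circuit.eval (Circuit.eval U G) c := by
  induction c with
  | nil => rfl
  | cons g c ih =>
    ext1 ψ
    cases g with
    | free V =>
      change Circuit.eval U (Circuit.expand G c) (V ψ) = _
      rw [ih]; rfl
    | query =>
      change Circuit.eval U (G ++ Circuit.expand G c) ψ = _
      rw [Circuit.eval_append, ih]; rfl
    | queryInv =>
      change Circuit.eval U (Circuit.inv G ++ Circuit.expand G c) ψ = _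
      rw [Circuit.eval_append, ih, eval_inv]; rfl

theorem dist_expand {B ι : Type} (U : Unitary B) (G : Circuit B) (P : Program B ι) :
    (P.expand G).dist U = P.dist (Circuit.eval U G) := by
  induction P with
  | output i => rfl
  | run init c next ih =>
    simp only [Program.expand, Program.dist, ih, eval_expand]

theorem queries_inv {B : Type} (c : Circuit B) :
    Circuit.queries (Circuit.inv c) = Circuit.queries c := by
  simp only [Circuit.queries, Circuit.inv, List.map_reverse, List.sum_reverse, List.map_map]
  congr 2
  funext g
  cases g <;> rfl

theorem queries_expand {B : Type} (G c : Circuit B) :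
    Circuit.queries (Circuit.expand G c) = Circuit.queries G * Circuit.queries c := by
  induction c with
  | nil => rfl
  | cons g c ih =>
    have h : Circuit.queries (g :: c) = g.queries + Circuit.queries c := by
      simp [Circuit.queries]
    rw [h, mul_add, ← ih]
    have hc : Circuit.expand G (g :: c) = Circuit.expand G [g] ++ Circuit.expand G c := by
      simp [Circuit.expand]
    rw [hc, queries_append]
    congr 1
    cases g with
    | free V => rfl
    | query => simp [Circuit.expand, Gate.queries]
    | queryInv => simp [Circuit.expand, Gate.queries, queries_inv]

theorem program_queries_expand_le {B ι : Type} (G : Circuit B) (P : Program B ι) :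
    (P.expand G).queries ≤ Circuit.queries G * P.queries := by
  induction P with
  | output i => exact zero_le
  | run init c next ih =>
    rw [Program.expand, Program.queries, Program.queries, queries_expand, mul_add, Nat.cast_mul]
    gcongr
    exact iSup_le fun b => (ih b).trans (by gcongr; exact le_iSup (fun b => (next b).queries) b)

/-- The forward-difference estimate of the `i`-th partial derivative. -/
def forwardDifference (f : EuclideanSpace ℝ (Fin d) → ℝ) (σ : ℝ) (x : EuclideanSpace ℝ (Fin d))
    (i : Fin d) : ℝ :=
  (f (x + σ • EuclideanSpace.single i (1 : ℝ)) - f x) / σ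

/-- On the value register: `a ↦ -σ a`, then `f (x + σ e_i)` is added and `f x` subtracted, then
division by `-σ`. The identity is exact on every basis label. -/
theorem eval_negGradCircuit (f : EuclideanSpace ℝ (Fin d) → ℝ) {σ : ℝ} (hσ : σ ≠ 0) :
    Circuit.eval (functionOracle f) (negGradCircuit d σ) =
      valueOracle fun x i => -forwardDifference f σ x i := by
  ext ψ r
  obtain ⟨i, x, a⟩ := r
  simp only [negGradCircuit, gradCircuit, Circuit.eval, Gate.eval, List.cons_append,
    List.nil_append, scaleGate, shiftGate, functionOracle, valueOracle, hσ, dif_neg,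
    not_false_eq_true, neg_eq_zero, one_ne_zero]
  refine congrArg (ψ : Reg d → ℂ) ?_
  simp [forwardDifference, Equiv.mulLeft₀]
  field_simp
  ring

theorem queries_negGradCircuit (σ : ℝ) : Circuit.queries (negGradCircuit d σ) = 2 := rfl

/-! ### Convex functions with Lipschitz gradient -/

section Convex

variable {f : EuclideanSpace ℝ (Fin d) → ℝ} {L : ℝ}

theorem inner_gradient_le (hf : ConvexOn ℝ Set.univ f) (hd : Differentiable ℝ f)
    (x y : EuclideanSpace ℝ (Fin d)) : inner ℝ (y - x) (gradient f x) ≤ f y - f x := by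
  have hline : HasDerivAt (fun t : ℝ => x + t • (y - x)) (y - x) 0 := by
    simpa using ((hasDerivAt_id (0 : ℝ)).smul_const (y - x)).const_add x
  have h1 : HasDerivAt (fun t : ℝ => f (x + t • (y - x))) (inner ℝ (y - x) (gradient f x)) 0 := by
    have h2 := (hd x).hasGradientAt.hasFDerivAt.comp_hasDerivAt_of_eq (0 : ℝ) hline (by simp)
    rw [real_inner_comm]
    exact h2
  have hconv : ConvexOn ℝ Set.univ (fun t : ℝ => f (x + t • (y - x))) := by
    have h2 := hf.comp_affineMap (AffineMap.lineMap x y : ℝ →ᵃ[ℝ] EuclideanSpace ℝ (Fin d))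
    refine h2.congr fun t _ => ?_
    simp [AffineMap.lineMap_apply, add_comm]
  have h3 := hconv.le_slope_of_hasDerivAt (Set.mem_univ 0) (Set.mem_univ 1) zero_lt_one h1
  simpa [slope_def_field] using h3

/-- Convexity at `y` bounds `f y - f x` by `⟨y - x, ∇f y⟩`; Cauchy–Schwarz does the rest. The
constant is `L` instead of `L / 2`, which is still small enough here. -/
theorem bregman_le (hf : ConvexOn ℝ Set.univ f) (hs : IsLSmooth L f)
    (x y : EuclideanSpace ℝ (Fin d)) :
    f y - f x - inner ℝ (y - x) (gradient f x) ≤ L * ‖y - x‖ ^ 2 := by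
  have h1 := inner_gradient_le hf hs.1 y x
  have h2 := real_inner_le_norm (y - x) (gradient f y - gradient f x)
  have h3 := mul_le_mul_of_nonneg_left (hs.2 y x) (norm_nonneg (y - x))
  rw [← neg_sub y x, inner_neg_left] at h1
  rw [inner_sub_right] at h2
  linarith

theorem convex_simplex : Convex ℝ (simplex d) := convex_convexHull ℝ _

theorem single_mem_simplex (i : Fin d) : EuclideanSpace.single i (1 : ℝ) ∈ simplex d :=
  subset_convexHull ℝ _ ⟨i, rfl⟩

theorem isBounded_simplex : Bornology.IsBounded (simplex d) :=
  isBounded_convexHull.2 (Set.finite_range _).isBounded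

/-- The sign of `L` is not assumed; it is needed for the precisions `σ_t` to be positive. -/
theorem pos_of_curvature_pos (hf : ConvexOn ℝ Set.univ f) (hs : IsLSmooth L f)
    (hC : 0 < curvature f (simplex d)) : 0 < L := by
  by_contra! hL
  refine hC.not_ge (Real.sSup_nonpos ?_)
  rintro r ⟨x, -, s, -, β, -, y, -, rfl⟩
  refine mul_nonpos_of_nonneg_of_nonpos (by positivity) ?_
  exact (bregman_le hf hs x y).trans (mul_nonpos_of_nonpos_of_nonneg hL (by positivity))

theorem le_curvature (hf : ConvexOn ℝ Set.univ f) (hs : IsLSmooth L f) (hL : 0 ≤ L)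
    {x s : EuclideanSpace ℝ (Fin d)} (hx : x ∈ simplex d) (hs' : s ∈ simplex d) {β : ℝ}
    (hβ : β ∈ Set.Ioc (0 : ℝ) 1) :
    f (x + β • (s - x)) ≤ f x + β * inner ℝ (s - x) (gradient f x) +
      β ^ 2 / 2 * curvature f (simplex d) := by
  -- An unbounded set would have the default supremum 0; smoothness and the bounded simplex exclude
  -- this, the factor `β ^ 2` cancelling.
  have hb : BddAbove {r : ℝ | ∃ x ∈ simplex d, ∃ s ∈ simplex d, ∃ β ∈ Set.Ioc (0 : ℝ) 1,
      ∃ y, y = x + β • (s - x) ∧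
        r = 2 / β ^ 2 * (f y - f x - inner ℝ (y - x) (gradient f x))} := by
    refine ⟨2 * (L * Metric.diam (simplex d) ^ 2), ?_⟩
    rintro r ⟨x, hx, s, hs', β, hβ, y, rfl, rfl⟩
    have h1 := bregman_le hf hs x (x + β • (s - x))
    have h2 : ‖s - x‖ ≤ Metric.diam (simplex d) := by
      rw [← dist_eq_norm]
      exact Metric.dist_le_diam_of_mem isBounded_simplex hs' hx
    rw [add_sub_cancel_left] at h1 ⊢
    rw [norm_smul, mul_pow, Real.norm_eq_abs, sq_abs] at h1
    have hβ0 := hβ.1.ne'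
    calc _ ≤ 2 / β ^ 2 * (L * (β ^ 2 * ‖s - x‖ ^ 2)) := by gcongr
      _ = 2 * (L * ‖s - x‖ ^ 2) := by field_simp
      _ ≤ _ := by gcongr
  have h := le_csSup hb ⟨x, hx, s, hs', β, hβ, _, rfl, rfl⟩
  change _ ≤ curvature f (simplex d) at h
  rw [add_sub_cancel_left, real_inner_smul_left] at h
  have hβ0 := hβ.1.ne'
  have h2 := mul_le_mul_of_nonneg_left h (by positivity : 0 ≤ β ^ 2 / 2)
  rw [← mul_assoc, show β ^ 2 / 2 * (2 / β ^ 2) = 1 by field_simp, one_mul] at h2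
  linarith

/-- By convexity the estimate errs upwards only, so comparing two estimates costs `L * σ` once. -/
theorem le_forwardDifference (hf : ConvexOn ℝ Set.univ f) (hs : IsLSmooth L f) {σ : ℝ}
    (hσ : 0 < σ) (x : EuclideanSpace ℝ (Fin d)) (i : Fin d) :
    inner ℝ (EuclideanSpace.single i (1 : ℝ)) (gradient f x) ≤ forwardDifference f σ x i := by
  have h := inner_gradient_le hf hs.1 x (x + σ • EuclideanSpace.single i (1 : ℝ))
  rw [add_sub_cancel_left, real_inner_smul_left] at h
  rw [forwardDifference, le_div_iff₀ hσ]
  linarith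

theorem forwardDifference_le (hf : ConvexOn ℝ Set.univ f) (hs : IsLSmooth L f) {σ : ℝ}
    (hσ : 0 < σ) (x : EuclideanSpace ℝ (Fin d)) (i : Fin d) :
    forwardDifference f σ x i ≤
      inner ℝ (EuclideanSpace.single i (1 : ℝ)) (gradient f x) + L * σ := by
  have h := bregman_le hf hs x (x + σ • EuclideanSpace.single i (1 : ℝ))
  rw [add_sub_cancel_left, real_inner_smul_left, norm_smul, PiLp.norm_single, norm_one,
    mul_one, Real.norm_eq_abs, sq_abs] at h
  rw [forwardDifference, div_le_iff₀ hσ]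
  linarith

/-- Minimizing the forward differences is an approximate linear minimization over the simplex. -/
theorem inner_single_le (hf : ConvexOn ℝ Set.univ f) (hs : IsLSmooth L f) {σ : ℝ}
    (hσ : 0 < σ) (x : EuclideanSpace ℝ (Fin d)) {k : Fin d}
    (hk : ∀ j, forwardDifference f σ x k ≤ forwardDifference f σ x j)
    {y : EuclideanSpace ℝ (Fin d)} (hy : y ∈ simplex d) :
    inner ℝ (EuclideanSpace.single k (1 : ℝ)) (gradient f x) ≤
      inner ℝ y (gradient f x) + L * σ := by
  have hsub : simplex d ⊆ {y | inner ℝ (EuclideanSpace.single k (1 : ℝ)) (gradient f x) - L * σ ≤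
      inner ℝ y (gradient f x)} := by
    refine convexHull_min ?_ (convex_halfSpace_ge ⟨fun _ _ => inner_add_left _ _ _,
      fun _ _ => real_inner_smul_left _ _ _⟩ _)
    rintro _ ⟨j, rfl⟩
    have h1 := le_forwardDifference hf hs hσ x k
    have h2 := forwardDifference_le hf hs hσ x j
    have h3 := hk j
    simp only [Set.mem_ofPred_eq]
    linarith
  have := hsub hy
  simp only [Set.mem_ofPred_eq] at this
  linarith

theorem stepSize_mem (t : ℕ) : stepSize t ∈ Set.Ioc (0 : ℝ) 1 := by
  have ht : (0 : ℝ) ≤ t := Nat.cast_nonneg t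
  refine ⟨by rw [stepSize]; positivity, ?_⟩
  rw [stepSize, div_le_one (by positivity)]
  linarith

/-- The progress of one round with an approximate linear minimization. -/
theorem frankWolfe_step (hf : ConvexOn ℝ Set.univ f) (hs : IsLSmooth L f) (hL : 0 ≤ L) (t : ℕ)
    {σ : ℝ} (hσ : 0 < σ) (hLσ : L * σ ≤ stepSize t / 2 * curvature f (simplex d))
    {x : EuclideanSpace ℝ (Fin d)} (hx : x ∈ simplex d) {k : Fin d}
    (hk : ∀ j, forwardDifference f σ x k ≤ forwardDifference f σ x j)
    {y : EuclideanSpace ℝ (Fin d)} (hy : y ∈ simplex d) :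
    f ((1 - stepSize t) • x + stepSize t • EuclideanSpace.single k (1 : ℝ)) - f y ≤
      (1 - stepSize t) * (f x - f y) + stepSize t ^ 2 * curvature f (simplex d) := by
  have h1 := le_curvature hf hs hL hx (single_mem_simplex k) (stepSize_mem t)
  have h2 := inner_single_le hf hs hσ x hk hy
  have h3 := inner_gradient_le hf hs.1 x y
  have hγ := (stepSize_mem t).1
  rw [inner_sub_left] at h1 h3
  -- The estimation error gives one half of `γ ^ 2 * C`, the curvature term in `h1` the other.
  have h4 := mul_le_mul_of_nonneg_left (h2.trans (add_le_add_right hLσ _)) hγ.le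
  have h5 := mul_le_mul_of_nonneg_left h3 hγ.le
  have hpt : (1 - stepSize t) • x + stepSize t • EuclideanSpace.single k (1 : ℝ) =
      x + stepSize t • (EuclideanSpace.single k (1 : ℝ) - x) := by
    rw [smul_sub, sub_smul, one_smul]; abel
  rw [hpt]
  linarith

/-- The points that satisfy the guarantee of the Frank-Wolfe algorithm after `t` rounds. -/
def frankWolfeGood (f : EuclideanSpace ℝ (Fin d) → ℝ) (t : ℕ) :
    Set (EuclideanSpace ℝ (Fin d)) :=
  {x | x ∈ simplex d ∧ (t ≠ 0 → ∀ y ∈ simplex d,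
    f x - f y ≤ 4 * curvature f (simplex d) / (t + 2))}

theorem frankWolfeGood_succ (hf : ConvexOn ℝ Set.univ f) (hs : IsLSmooth L f) (hL : 0 ≤ L)
    (hC : 0 ≤ curvature f (simplex d)) (t : ℕ)
    {σ : ℝ} (hσ : 0 < σ) (hLσ : L * σ ≤ stepSize t / 2 * curvature f (simplex d))
    {x : EuclideanSpace ℝ (Fin d)} (hx : x ∈ frankWolfeGood f t) {k : Fin d}
    (hk : ∀ j, forwardDifference f σ x k ≤ forwardDifference f σ x j) :
    (1 - stepSize t) • x + stepSize t • EuclideanSpace.single k (1 : ℝ) ∈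
      frankWolfeGood f (t + 1) := by
  have hγ := stepSize_mem t
  refine ⟨convex_simplex hx.1 (single_mem_simplex k) (sub_nonneg.2 hγ.2) hγ.1.le
    (sub_add_cancel _ _), fun _ y hy => ?_⟩
  refine (frankWolfe_step hf hs hL t hσ hLσ hx.1 hk hy).trans ?_
  set C := curvature f (simplex d)
  -- At `t = 0` the step size is 1, so the unbounded initial gap drops out and `C ≤ 4 * C / 3`
  -- suffices.
  rcases Nat.eq_zero_or_pos t with rfl | ht
  · norm_num [stepSize]
    linarith
  · have h1 := mul_le_mul_of_nonneg_left (hx.2 ht.ne' y hy) (sub_nonneg.2 hγ.2)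
    refine (add_le_add_left h1 _).trans ?_
    have ht0 : (0 : ℝ) ≤ t := Nat.cast_nonneg t
    rw [stepSize]
    push_cast
    rw [show (1 - 2 / ((t : ℝ) + 2)) * (4 * C / (t + 2)) + (2 / ((t : ℝ) + 2)) ^ 2 * C =
      4 * C * (t + 1) / (t + 2) ^ 2 by field_simp; ring,
      div_le_div_iff₀ (by positivity) (by positivity)]
    -- The remaining inequality is `(t + 1) * (t + 3) ≤ (t + 2) ^ 2`, scaled by `4 * C`.
    nlinarith

end Convex

/-! ### The quantum Frank-Wolfe algorithm -/

/-- The bound for maximum finding holds at every point, hence conditionally on any good iterate, so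
the success probabilities multiply. -/
theorem prob_frankWolfeGood {f : EuclideanSpace ℝ (Fin d) → ℝ} {L : ℝ}
    (hf : ConvexOn ℝ Set.univ f) (hs : IsLSmooth L f) (hL : 0 ≤ L)
    (hC : 0 ≤ curvature f (simplex d)) {σ : ℕ → ℝ} (hσ : ∀ t, 0 < σ t)
    (hLσ : ∀ t, L * σ t ≤ stepSize t / 2 * curvature f (simplex d))
    {A : IndexFinder d} {δ : ℝ} (hA : IsMaxFinding A δ)
    {x₀ : EuclideanSpace ℝ (Fin d)} (hx₀ : x₀ ∈ simplex d) (t : ℕ) :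
    ENNReal.ofReal (1 - δ) ^ t ≤
      (quantumFW f A σ x₀ t).toOuterMeasure (frankWolfeGood f t) := by
  induction t with
  | zero =>
    have : x₀ ∈ frankWolfeGood f 0 := ⟨hx₀, fun h => absurd rfl h⟩
    simp [quantumFW, PMF.toOuterMeasure_pure_apply, this]
  | succ t ih =>
    rw [quantumFW, PMF.toOuterMeasure_bind_apply, pow_succ]
    calc _ ≤ (quantumFW f A σ x₀ t).toOuterMeasure (frankWolfeGood f t) *
            ENNReal.ofReal (1 - δ) := by gcongr
      _ = ∑' x, (frankWolfeGood f t).indicator (quantumFW f A σ x₀ t) x *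
            ENNReal.ofReal (1 - δ) := by rw [PMF.toOuterMeasure_apply, ENNReal.tsum_mul_right]
      _ ≤ _ := by
        refine ENNReal.tsum_le_tsum fun x => ?_
        by_cases hx : x ∈ frankWolfeGood f t
        · rw [Set.indicator_of_mem hx]
          gcongr
          rw [PMF.toOuterMeasure_map_apply, roundProgram, dist_expand,
            eval_negGradCircuit f (hσ t).ne']
          refine (hA _ x).trans (MeasureTheory.measure_mono fun k hk => ?_)
          exact frankWolfeGood_succ hf hs hL hC t (hσ t) (hLσ t) hx
            fun j => neg_le_neg_iff.1 (hk j)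
        · rw [Set.indicator_of_notMem hx, zero_mul]
          exact zero_le

theorem gradPrecision_pos [NeZero d] {L C : ℝ} (hL : 0 < L) (hC : 0 < C) (t : ℕ) :
    0 < gradPrecision d L C t := by
  have hd : (0 : ℝ) < d := by exact_mod_cast Nat.pos_of_ne_zero (NeZero.ne d)
  rw [gradPrecision]
  positivity

/-- Equality would hold without `√d` in the precision; that factor only shrinks the error. -/
theorem mul_gradPrecision_le [NeZero d] {L C : ℝ} (hL : 0 < L) (hC : 0 < C) (t : ℕ) :
    L * gradPrecision d L C t ≤ stepSize t / 2 * C := by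
  have hd : (1 : ℝ) ≤ √(d : ℝ) := by
    rw [Real.one_le_sqrt]
    exact_mod_cast Nat.one_le_iff_ne_zero.2 (NeZero.ne d)
  have ht : (0 : ℝ) < t + 2 := by positivity
  have h1 : L * gradPrecision d L C t = C / (t + 2) / √(d : ℝ) := by
    rw [gradPrecision]; field_simp
  have h2 : stepSize t / 2 * C = C / (t + 2) := by rw [stepSize]; field_simp
  rw [h1, h2]
  exact div_le_self (by positivity) hd

theorem le_numRounds (C ε : ℝ) : 4 * C / ε - 2 ≤ numRounds C ε :=
  (Nat.le_ceil _).trans (by exact_mod_cast le_max_right _ _)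

theorem one_le_numRounds (C ε : ℝ) : 1 ≤ numRounds C ε := le_max_left _ _

theorem numRounds_le (C ε : ℝ) :
    (numRounds C ε : ℝ) ≤ 4 * max 1 (C / ε) := by
  have h1 := le_max_left 1 (C / ε)
  have h2 := le_max_right 1 (C / ε)
  rw [numRounds, Nat.cast_max, Nat.cast_one]
  refine max_le (by linarith) ?_
  rcases le_total (4 * C / ε - 2) 0 with h | h
  · rw [Nat.ceil_eq_zero.2 h]
    push_cast
    linarith
  · have := (Nat.ceil_lt_add_one h).le
    rw [mul_div_assoc] at this
    rw [mul_div_assoc]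
    linarith

theorem frankWolfeGood_numRounds_subset {f : EuclideanSpace ℝ (Fin d) → ℝ} {ε : ℝ} (hε : 0 < ε) :
    frankWolfeGood f (numRounds (curvature f (simplex d)) ε) ⊆
      {x | IsEpsOptimal f (simplex d) ε x} := by
  intro x hx
  have h1 := one_le_numRounds (curvature f (simplex d)) ε
  refine ⟨hx.1, fun y hy => (hx.2 (by lia) y hy).trans ?_⟩
  have h2 := le_numRounds (curvature f (simplex d)) ε
  rw [div_le_iff₀ (by positivity), mul_comm ε, ← div_le_iff₀ hε]
  linarith

/-- The leading 2 counts the calls per value query. From `144 * 4 ≤ 2 ^ 10` and `M ≥ 2` the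
logarithm is at most `11 * log M`, giving `117 + 792 * log M`; `log 2 > 0.69` absorbs the constant.
-/
theorem ceil_log_le (C ε : ℝ) {p : ℝ} (hp : 0 < p) :
    2 * (54 + 9 / 2 * (⌈8 * Real.log (144 / (p / numRounds C ε))⌉₊ : ℝ)) ≤
      1000 * Real.log (max 2 (max 1 (C / ε) / p)) := by
  set M := max 2 (max 1 (C / ε) / p)
  have hT : (1 : ℝ) ≤ numRounds C ε := by exact_mod_cast one_le_numRounds C ε
  have hM2 : 2 ≤ M := le_max_left _ _
  have hlogM : Real.log 2 ≤ Real.log M := Real.log_le_log two_pos hM2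
  have hlog2 := Real.log_two_gt_d9
  have h1 : 144 / (p / numRounds C ε) ≤ 2 ^ 10 * M := by
    have h2 : (numRounds C ε : ℝ) / p ≤ 4 * M := by
      refine (div_le_div_of_nonneg_right (numRounds_le C ε) hp.le).trans ?_
      rw [mul_div_assoc]
      gcongr
      exact le_max_right _ _
    rw [← div_mul, div_mul_eq_mul_div, mul_div_assoc]
    linarith
  have h2 : Real.log (144 / (p / numRounds C ε)) ≤ 11 * Real.log M := by
    refine (Real.log_le_log (by positivity) h1).trans ?_
    rw [Real.log_mul (by norm_num) (by linarith), Real.log_pow]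
    push_cast
    linarith
  have h3 : (⌈8 * Real.log (144 / (p / numRounds C ε))⌉₊ : ℝ) ≤ 88 * Real.log M + 1 := by
    refine (Nat.cast_le.2 (Nat.ceil_mono (by linarith : _ ≤ 88 * Real.log M))).trans ?_
    exact (Nat.ceil_lt_add_one (by linarith)).le
  linarith

end

end QuantumFW

theorem theorem2 :
    ∃ (K : ℝ) (A : (d : ℕ) → [NeZero d] → ℝ → QuantumFW.IndexFinder d),
      0 < K ∧
      (∀ (d : ℕ) [NeZero d] (δ : ℝ), 0 < δ → δ < 1 → QuantumFW.IsMaxFinding (A d δ) δ) ∧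
      ∀ (d : ℕ) [NeZero d] (L : ℝ) (f : EuclideanSpace ℝ (Fin d) → ℝ) (C : ℝ),
        ConvexOn ℝ Set.univ f → QuantumFW.IsLSmooth L f →
        C = QuantumFW.curvature f (QuantumFW.simplex d) → 0 < C →
        ∀ (ε p : ℝ), 0 < ε → 0 < p → p < 1 →
        ∀ x₀ ∈ QuantumFW.simplex d,
          (ENNReal.ofReal (1 - p) ≤
            (QuantumFW.quantumFW f (A d (p / QuantumFW.numRounds C ε))
                (QuantumFW.gradPrecision d L C) x₀
                (QuantumFW.numRounds C ε)).toOuterMeasure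
              {x | QuantumFW.IsEpsOptimal f (QuantumFW.simplex d) ε x}) ∧
          ∀ t < QuantumFW.numRounds C ε, ∀ x : EuclideanSpace ℝ (Fin d),
            (QuantumFW.roundProgram (A d (p / QuantumFW.numRounds C ε))
                (QuantumFW.gradPrecision d L C t) x).queries ≤
              (⌊K * √(d : ℝ) * Real.log (max 2 (max 1 (C / ε) / p))⌋₊ : ℕ∞) := by
  refine ⟨1000, fun d _ δ => QuantumFW.maxFinder d δ, by norm_num,
    fun d _ δ hδ _ => QuantumFW.isMaxFinding_maxFinder d hδ, ?_⟩
  intro d _ L f C hf hs hC hC0 ε p hε hp hp1 x₀ hx₀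
  subst hC
  have hL := QuantumFW.pos_of_curvature_pos hf hs hC0
  set C := QuantumFW.curvature f (QuantumFW.simplex d)
  set T := QuantumFW.numRounds C ε
  have hT : (1 : ℝ) ≤ T := by exact_mod_cast QuantumFW.one_le_numRounds C ε
  have hδ : 0 < p / T := by positivity
  constructor
  · have h1 := QuantumFW.prob_frankWolfeGood hf hs hL.le hC0.le
      (QuantumFW.gradPrecision_pos (d := d) hL hC0)
      (QuantumFW.mul_gradPrecision_le (d := d) hL hC0)
      (QuantumFW.isMaxFinding_maxFinder d hδ) hx₀ T
    refine le_trans ?_ (h1.trans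
      (MeasureTheory.measure_mono (QuantumFW.frankWolfeGood_numRounds_subset hε)))
    have hδ1 : p / T ≤ 1 := div_le_one_of_le₀ (by linarith) (by positivity)
    rw [← ENNReal.ofReal_pow (by linarith)]
    refine ENNReal.ofReal_le_ofReal ?_
    -- Bernoulli's inequality: `(1 - p / T) ^ T ≥ 1 - p`.
    have h2 := one_add_mul_le_pow (by linarith : -2 ≤ -(p / (T : ℝ))) T
    rw [mul_neg, mul_div_cancel₀ p (by positivity : (T : ℝ) ≠ 0)] at h2
    simpa [sub_eq_add_neg] using h2
  · intro t _ x
    obtain ⟨n, hn, hn'⟩ := QuantumFW.queries_maxFinder_le d (p / T) x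
    refine (QuantumFW.program_queries_expand_le _ _).trans ?_
    rw [QuantumFW.queries_negGradCircuit]
    calc _ ≤ ((2 : ℕ) : ℕ∞) * n := by gcongr
      _ = ((2 * n : ℕ) : ℕ∞) := by push_cast; rfl
      _ ≤ _ := by
        refine Nat.cast_le.2 (Nat.le_floor ?_)
        have h1 := mul_le_mul_of_nonneg_left (QuantumFW.ceil_log_le C ε hp)
          (Real.sqrt_nonneg (d : ℝ))
        push_cast
        linarith
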